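/- Let $n \ge 1$. Consider the $n\times n$ square of the square lattice, with its $n^2$ vertices and all $2n(n+1)$ edges adjacent to them, of which $4n$ are boundary edges. A fully-packed loop configuration (FPL) is a colouring of the edges in black and white such that each vertex is adjacent to two black and two white edges. Let $\mathrm{Fpl}(n)$ be the set of FPLs with alternating boundary conditions: going counter-clockwise along the boundary from the vertical boundary edge at the bottom-left corner, the boundary edges are coloured black, white, black, white, …, black, white. Label the black boundary edges $1,\dots,2n$ in this order. A link pattern is a non-crossing perfect matching of the points $1,\dots,2n$ placed cyclically on the boundary of a disk; write $\mathrm{LP}(n)$ for the set of link patterns, $\pi(i)$ for the point matched with $i$, and take indices modulo $2n$. Every $\phi\in\mathrm{Fpl}(n)$ has exactly one link pattern $\pi(\phi)\in\mathrm{LP}(n)$, in which two distinct labels are matched if and only if the corresponding boundary edges are connected by a black path of $\phi$. Let $\Psi_n(\pi)$ be the number of $\phi\in\mathrm{Fpl}(n)$ with $\pi(\phi)=\pi$, and let $$|s_n\rangle=\sum_{\pi\in\mathrm{LP}(n)}\Psi_n(\pi)\,|\pi\rangle\in\mathbb{C}^{\mathrm{LP}(n)} .$$ For $1\le j\le 2n$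 let $e_j$ be the linear operator on $\mathbb{C}^{\mathrm{LP}(n)}$ with $e_j|\pi\rangle=|e_j(\pi)\rangle$, where $e_j(\pi)=\pi$ if $\pi(j)=j+1$, and otherwise $e_j(\pi)$ is obtained from $\pi$ by replacing the pairs $(j,\pi(j))$, $(j+1,\pi(j+1))$ by $(j,j+1)$, $(\pi(j),\pi(j+1))$. Let $H_n=\sum_{k=1}^{2n}e_k$. Then $$H_n|s_n\rangle=2n\,|s_n\rangle .$$ Moreover $|s_n\rangle$ is the ground state of $H_n$ (the Hamiltonian of the dense $O(1)$ loop model): $|s_n\rangle\ne 0$, every $v\in\mathbb{C}^{\mathrm{LP}(n)}$ with $H_n v=2n\,v$ is a scalar multiple of $|s_n\rangle$, and every eigenvalue $\mu$ of $H_n$ satisfies $|\mu|\le 2n$. -/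

import Mathlib

/-! ### Fully-packed loop configurations on the square -/

/-- The edges of the `n × n` square domain, boundary edges included. The vertices are the pairs
`(x, y) : Fin n × Fin n`, where `x` is the column (from the left) and `y` the row (from the bottom).
`h x y` is the `x`-th horizontal edge (from the left) in row `y`, and `v x y` is the `y`-th
vertical edge (from the bottom) in column `x`. -/
inductive Edge (n : ℕ) : Type
  | h (x : Fin (n + 1)) (y : Fin n) : Edge n
  | v (x : Fin n) (y : Fin (n + 1)) : Edge n
  deriving DecidableEq, Fintype

/-- The four edges (left, right, below, above) at a vertex. -/
def incidentEdges {n : ℕ} (p : Fin n × Fin n) : Finset (Edge n) :=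
  {Edge.h p.1.castSucc p.2, Edge.h p.1.succ p.2, Edge.v p.1 p.2.castSucc, Edge.v p.1 p.2.succ}

/-- The `4 n` boundary edges in counter-clockwise order: the bottom side from left to right,
the right side from bottom to top, the top side from right to left and the left side from top to
bottom. The first one is the vertical edge at the bottom-left corner. -/
def boundaryEdge {n : ℕ} (k : Fin (4 * n)) : Edge n :=
  if h₁ : k.val < n then Edge.v ⟨k.val, h₁⟩ 0
  else if h₂ : k.val < 2 * n then Edge.h (Fin.last n) ⟨k.val - n, by omega⟩
  else if h₃ : k.val < 3 * n then Edge.v ⟨3 * n - 1 - k.val, by omega⟩ (Fin.last n)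
  else Edge.h 0 ⟨4 * n - 1 - k.val, by omega⟩

/-- A colouring of the edges (`true` is black, `false` is white) obeys the ice rule if every vertex
is adjacent to two black and two white edges. -/
def IceRule {n : ℕ} (φ : Edge n → Bool) : Prop :=
  ∀ p : Fin n × Fin n, ((incidentEdges p).filter (fun e => φ e = true)).card = 2 ∧
    ((incidentEdges p).filter (fun e => φ e = false)).card = 2

/-- The alternating boundary condition `b w b w … b w`, starting with black. -/
def AlternatingBoundary {n : ℕ} (φ : Edge n → Bool) : Prop :=
  ∀ k : Fin (4 * n), φ (boundaryEdge k) = true ↔ Even k.val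

/-- Fully-packed loop configurations on the `n × n` square with alternating boundary conditions. -/
abbrev FPL (n : ℕ) : Type :=
  {φ : Edge n → Bool // IceRule φ ∧ AlternatingBoundary φ}

/-- The `i`-th black boundary edge, in counter-clockwise order (indices start from `0`). -/
def blackLeg {n : ℕ} (i : Fin (2 * n)) : Edge n :=
  boundaryEdge ⟨2 * i.val, by omega⟩

/-- The graph whose nodes are the edges of the square, two distinct black edges being adjacent when
they share a vertex. Its components of black edges are the black paths and the black cycles. -/
def blackGraph {n : ℕ} (φ : Edge n → Bool) : SimpleGraph (Edge n) where
  Adj e f := e ≠ f ∧ φ e = true ∧ φ f = true ∧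
    ∃ p : Fin n × Fin n, e ∈ incidentEdges p ∧ f ∈ incidentEdges p
  symm := ⟨fun _ _ ⟨hne, he, hf, p, hpe, hpf⟩ => ⟨hne.symm, hf, he, p, hpf, hpe⟩⟩
  loopless := ⟨fun _ h => h.1 rfl⟩

/-! ### Link patterns and the Temperley–Lieb operators -/

/-- `f`, which maps each of `2 n` cyclically ordered points to its partner, is a perfect matching
without crossings. -/
def IsLinkPattern {n : ℕ} (f : Fin (2 * n) → Fin (2 * n)) : Prop :=
  (∀ i, f (f i) = i) ∧ (∀ i, f i ≠ i) ∧ ∀ i j, ¬ (i < j ∧ j < f i ∧ f i < f j)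

/-- Link patterns: non-crossing perfect matchings of `2 n` points on the boundary of a disk. -/
abbrev LinkPattern (n : ℕ) : Type :=
  {f : Fin (2 * n) → Fin (2 * n) // IsLinkPattern f}

noncomputable instance (n : ℕ) : Fintype (LinkPattern n) := Fintype.ofFinite _

/-- The cyclic successor `j + 1` of `j`, modulo `2 n`. -/
def cyclicSucc {n : ℕ} (j : Fin (2 * n)) : Fin (2 * n) :=
  ⟨(j.val + 1) % (2 * n), Nat.mod_lt _ (Nat.zero_lt_of_lt j.isLt)⟩

/-- The matching obtained from `f` by connecting `j` with `j + 1`, and the former partners of `j`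
and of `j + 1` with each other. -/
def reconnect {n : ℕ} (j : Fin (2 * n)) (f : Fin (2 * n) → Fin (2 * n)) (i : Fin (2 * n)) :
    Fin (2 * n) :=
  if i = j then cyclicSucc j
  else if i = cyclicSucc j then j
  else if i = f j then f (cyclicSucc j)
  else if i = f (cyclicSucc j) then f j
  else f i

theorem cyclicSucc_val {n : ℕ} (j : Fin (2 * n)) :
    (cyclicSucc j).val = j.val + 1 ∧ j.val + 1 < 2 * n ∨
      (cyclicSucc j).val = 0 ∧ j.val + 1 = 2 * n := by
  have hlt := j.isLt
  by_cases h : j.val + 1 = 2 * n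
  · right; simp [cyclicSucc, h]
  · left
    have h' : j.val + 1 < 2 * n := by omega
    exact ⟨by simp [cyclicSucc, Nat.mod_eq_of_lt h'], h'⟩

theorem isLinkPattern_reconnect {n : ℕ} (j : Fin (2 * n)) {f : Fin (2 * n) → Fin (2 * n)}
    (hf : IsLinkPattern f) (hj : f j ≠ cyclicSucc j) : IsLinkPattern (reconnect j f) := by
  obtain ⟨hinv, hne, hnc⟩ := hf
  have hs := cyclicSucc_val j
  have hlt := j.isLt
  generalize hk : cyclicSucc j = k at hs hj
  have hkj : k ≠ j := by
    rintro rfl; omega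
  have h1 := hinv j
  have h2 := hinv k
  have h3 := hne j
  have h4 := hne k
  have hg : ∀ i, reconnect j f i = if i = j then k else if i = k then j
      else if i = f j then f k else if i = f k then f j else f i := by
    intro i; simp [reconnect, hk]
  refine ⟨fun i => ?_, fun i => ?_, fun x y => ?_⟩
  · have := hinv i
    rw [hg, hg]
    grind
  · have := hne i
    rw [hg]
    grind
  · have hnc' : ∀ p q : Fin (2 * n),
        ¬ (p.val < q.val ∧ q.val < (f p).val ∧ (f p).val < (f q).val) := hnc
    rw [hg, hg]
    simp only [Fin.lt_def]
    have hx := hinv x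
    have hy := hinv y
    have hk' := k.isLt
    have bx := x.isLt
    have bY := y.isLt
    have bfx := (f x).isLt
    have bfy := (f y).isLt
    have bfj := (f j).isLt
    have bfk := (f k).isLt
    have side : ∀ p q : Fin (2 * n), q ≠ p → q ≠ f p →
        (p.val < q.val ∧ q.val < (f p).val ∨ (f p).val < q.val ∧ q.val < p.val →
        p.val < (f q).val ∧ (f q).val < (f p).val ∨
          (f p).val < (f q).val ∧ (f q).val < p.val) := by
      intro p q e1 e2
      have a1 := hnc' p q
      have a2 := hnc' (f p) q
      have a3 := hnc' (f q) p
      have a4 := hnc' (f q) (f p)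
      have b1 := hinv p
      have b2 := hinv q
      have c1 : f q ≠ p := by rintro rfl; exact e2 (hinv q).symm
      have c2 : f q ≠ f p := fun h => e1 (by rw [← hinv q, h, hinv p])
      rw [b1] at a2 a4
      rw [b2] at a3 a4
      rw [ne_eq, Fin.ext_iff] at e1 e2 c1 c2
      omega
    clear hnc hnc' hg
    have s1 := side j k
    have s2 := side j x
    have s3 := side j y
    have s4 := side k x
    have s5 := side k y
    have s6 := side x y
    have t2 := side j (f x)
    have t3 := side j (f y)
    have t4 := side k (f x)
    have t5 := side k (f y)
    have t6 := side x (f y)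
    have nx := hne x
    have ny := hne y
    clear side
    split_ifs <;> grind (splits := 40)

/-- The Temperley–Lieb operator `e_j` (with loop weight `1`) on link patterns. -/
def tlMap {n : ℕ} (j : Fin (2 * n)) (π : LinkPattern n) : LinkPattern n :=
  if hj : π.1 j = cyclicSucc j then π
  else ⟨reconnect j π.1, isLinkPattern_reconnect j π.2 hj⟩

/-- The Hamiltonian `H_n = ∑ e_k` on the complex vector space with basis the link patterns. -/
noncomputable def hamiltonian (n : ℕ) : Module.End ℂ (LinkPattern n →₀ ℂ) :=
  ∑ k : Fin (2 * n), Finsupp.lmapDomain ℂ ℂ (tlMap k)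

/-! ### The refined enumeration -/

/-- `π` is the link pattern of `φ`: two distinct black boundary edges are matched by `π` exactly if
a black path of `φ` connects them. -/
def HasLinkPattern {n : ℕ} (φ : FPL n) (π : LinkPattern n) : Prop :=
  ∀ i j : Fin (2 * n), i ≠ j →
    (π.1 i = j ↔ (blackGraph φ.1).Reachable (blackLeg i) (blackLeg j))

/-- `Ψ_n(π)`, the number of fully-packed loop configurations with link pattern `π`. -/
noncomputable def fplCount (n : ℕ) (π : LinkPattern n) : ℕ :=
  Nat.card {φ : FPL n // HasLinkPattern φ π}

/-- The vector `|s_n⟩ = ∑ Ψ_n(π) |π⟩`. -/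
noncomputable def fplState (n : ℕ) : LinkPattern n →₀ ℂ :=
  ∑ π : LinkPattern n, (fplCount n π : ℂ) • Finsupp.single π (1 : ℂ)

/-!
The proof is the combinatorial one, by Wieland's gyration.

Configurations are considered at a time `s`: at even times the boundary colours are `b w b w …`, at
odd times `w b w b …`, and the black boundary edges are labelled with a shift by `s`. Each edge lies
on exactly one face of a given parity. The half-gyration inverts the colours on all faces of one
parity except on those squares whose colours alternate. It is a bijection from the configurations at
time `s` to those at time `s + 1`, and it preserves the link pattern (`patternAt_gyration`), since a
black path and its image meet the same faces through the same vertices. Two steps bring the colours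
back but shift the labels by one. So the distribution of link patterns is invariant under rotation,
and it suffices to prove `∑ f(e(π(φ))) = ∑ f(π(φ))` for rotation invariant `f` and the single
operator `e` that acts on the last and the first label.

This is done in the bottom row, by following the labels in time (`sum_white_tlMap`). At time `x` the
first label sits at column `x`. Consider the configurations whose `x`-th horizontal edge in the
bottom row is white; for `x = 0` these are all configurations, for `x = n` there are none. If the
next horizontal edge is black, the half-gyration leads to the same kind at time `x + 1`. Otherwise the
first label runs straight up at column `x`. For `x = 0` it meets the last label at once, and `e` acts
trivially. For `x > 0` the last label runs up at column `x - 1`. If the face between these two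
vertical edges does not alternate, the two labels are connected along its top, and `e` again acts
trivially. If it alternates, flipping it realizes `e` (`patternAt_flipFace`) and leads to a
configuration whose `x`-th horizontal edge is black. Since the full gyration changes the colour of
that edge precisely when the face alternates, both colours occur equally often along each orbit
together with an alternating face (`sum_white_alternating`), so the contributions of `e(π)` and `π`
cancel.

That each configuration has a link pattern (`exists_patternAt`) rests on two facts. A component of
black edges is connected with degrees at most two, so it contains at most two boundary edges. And the
faces can be two-coloured so that the colour changes exactly across the edges of a component; along
the boundary this gives a second boundary edge in the component of each black one, and it prevents
crossings.

The remaining claims are of Perron–Frobenius type: each `e_k` is a contraction in the `ℓ¹` norm, and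
`e_{2 n - 2} ⋯ e_2 e_0` sends all link patterns to the same one, so that `H ^ n` is a strict
contraction, relative to the factor `(2 n) ^ n`, on vectors with vanishing sum of coefficients.
-/

/-! ### Colourings in integer coordinates -/

/-- The colour of the horizontal edge in position `(x, y)`, for natural coordinates; the value
outside the square is the junk colour `false`. -/
def hColor {n : ℕ} (φ : Edge n → Bool) (x y : ℕ) : Bool :=
  if h : x < n + 1 ∧ y < n then φ (Edge.h ⟨x, h.1⟩ ⟨y, h.2⟩) else false

/-- The colour of the vertical edge in position `(x, y)`, for natural coordinates; the value
outside the square is the junk colour `false`. -/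
def vColor {n : ℕ} (φ : Edge n → Bool) (x y : ℕ) : Bool :=
  if h : x < n ∧ y < n + 1 then φ (Edge.v ⟨x, h.1⟩ ⟨y, h.2⟩) else false

theorem apply_h {n : ℕ} (φ : Edge n → Bool) (x : Fin (n + 1)) (y : Fin n) :
    φ (Edge.h x y) = hColor φ x.val y.val := by
  rw [hColor, dif_pos ⟨x.2, y.2⟩]

theorem apply_v {n : ℕ} (φ : Edge n → Bool) (x : Fin n) (y : Fin (n + 1)) :
    φ (Edge.v x y) = vColor φ x.val y.val := by
  rw [vColor, dif_pos ⟨x.2, y.2⟩]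

theorem h_mem_incidentEdges {n : ℕ} {x : Fin (n + 1)} {y : Fin n} {p : Fin n × Fin n} :
    Edge.h x y ∈ incidentEdges p ↔ (x.val = p.1.val ∨ x.val = p.1.val + 1) ∧ y.val = p.2.val := by
  obtain ⟨a, b⟩ := p
  simp only [incidentEdges, Finset.mem_insert, Finset.mem_singleton, Edge.h.injEq, reduceCtorEq,
    or_false, Fin.ext_iff, Fin.val_castSucc, Fin.val_succ]
  tauto

theorem v_mem_incidentEdges {n : ℕ} {x : Fin n} {y : Fin (n + 1)} {p : Fin n × Fin n} :
    Edge.v x y ∈ incidentEdges p ↔ x.val = p.1.val ∧ (y.val = p.2.val ∨ y.val = p.2.val + 1) := by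
  obtain ⟨a, b⟩ := p
  simp only [incidentEdges, Finset.mem_insert, Finset.mem_singleton, Edge.v.injEq, reduceCtorEq,
    false_or, Fin.ext_iff, Fin.val_castSucc, Fin.val_succ]
  tauto

theorem sum_incidentEdges {n : ℕ} {M : Type*} [AddCommMonoid M] (g : Edge n → M)
    (p : Fin n × Fin n) :
    ∑ e ∈ incidentEdges p, g e = g (Edge.h p.1.castSucc p.2) + (g (Edge.h p.1.succ p.2) +
      (g (Edge.v p.1 p.2.castSucc) + g (Edge.v p.1 p.2.succ))) := by
  rw [incidentEdges, Finset.sum_insert, Finset.sum_insert, Finset.sum_insert,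
    Finset.sum_singleton] <;> simp [Fin.ext_iff]

/-- The ice rule as a count of black edges in coordinates. -/
theorem iceRule_iff {n : ℕ} {φ : Edge n → Bool} :
    IceRule φ ↔ ∀ x y : ℕ, x < n → y < n →
      (hColor φ x y).toNat + (hColor φ (x + 1) y).toNat +
        (vColor φ x y).toNat + (vColor φ x (y + 1)).toNat = 2 := by
  have key : ∀ p : Fin n × Fin n,
      (((incidentEdges p).filter (fun e => φ e = true)).card = 2 ∧
        ((incidentEdges p).filter (fun e => φ e = false)).card = 2) ↔
      (hColor φ p.1 p.2).toNat + (hColor φ (p.1 + 1) p.2).toNat +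
        (vColor φ p.1 p.2).toNat + (vColor φ p.1 (p.2 + 1)).toNat = 2 := by
    intro p
    rw [Finset.card_filter, Finset.card_filter, sum_incidentEdges, sum_incidentEdges]
    simp only [apply_h, apply_v, Fin.val_castSucc, Fin.val_succ]
    cases hColor φ p.1 p.2 <;> cases hColor φ (p.1 + 1) p.2 <;> cases vColor φ p.1 p.2 <;>
      cases vColor φ p.1 (p.2 + 1) <;> simp
  constructor
  · intro h x y hx hy
    exact (key (⟨x, hx⟩, ⟨y, hy⟩)).1 (h _)
  · intro h p
    exact (key p).2 (h _ _ p.1.2 p.2.2)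

/-- The alternating boundary condition at time `s`: the boundary edge `k` is black exactly if
`k + s` is even. Even times give the colours `b w b w …`, odd times `w b w b …`. -/
def BoundaryAt {n : ℕ} (s : ℕ) (φ : Edge n → Bool) : Prop :=
  ∀ k : Fin (4 * n), φ (boundaryEdge k) = true ↔ Even (k.val + s)

theorem boundaryAt_iff {n : ℕ} {s : ℕ} {φ : Edge n → Bool} :
    BoundaryAt s φ ↔
      (∀ x < n, (vColor φ x 0 = true ↔ Even (x + s))) ∧
      (∀ y < n, (hColor φ n y = true ↔ Even (n + y + s))) ∧
      (∀ x < n, (vColor φ x n = true ↔ ¬ Even (x + n + s))) ∧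
      (∀ y < n, (hColor φ 0 y = true ↔ ¬ Even (y + s))) := by
  constructor
  · intro h
    refine ⟨fun x hx => ?_, fun y hy => ?_, fun x hx => ?_, fun y hy => ?_⟩
    · have := h ⟨x, by omega⟩
      simpa [boundaryEdge, hx, apply_v] using this
    · have := h ⟨n + y, by omega⟩
      simpa [boundaryEdge, apply_h, show n + y < 2 * n by omega] using this
    · have := h ⟨3 * n - 1 - x, by omega⟩
      rw [boundaryEdge, dif_neg (by simp; omega), dif_neg (by simp; omega),
        dif_pos (by simp; omega), apply_v φ] at this
      simp only [Fin.val_last] at this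
      rw [show 3 * n - 1 - (3 * n - 1 - x) = x by omega] at this
      rw [this, Nat.even_iff, Nat.even_iff]
      omega
    · have := h ⟨4 * n - 1 - y, by omega⟩
      rw [boundaryEdge, dif_neg (by simp; omega), dif_neg (by simp; omega),
        dif_neg (by simp; omega), apply_h φ] at this
      simp only [Fin.val_zero] at this
      rw [show 4 * n - 1 - (4 * n - 1 - y) = y by omega] at this
      rw [this, Nat.even_iff, Nat.even_iff]
      omega
  · rintro ⟨h1, h2, h3, h4⟩ ⟨k, hk⟩
    unfold boundaryEdge
    split_ifs with c1 c2 c3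
    · simpa [apply_v] using h1 k c1
    · simp only at c1 c2
      rw [apply_h φ, Fin.val_last, h2 _ (by simp; omega)]
      rw [Nat.even_iff, Nat.even_iff]
      simp only
      omega
    · simp only at c1 c2 c3
      rw [apply_v φ, Fin.val_last, h3 _ (by simp; omega)]
      rw [Nat.even_iff, Nat.even_iff]
      simp only
      omega
    · simp only at c1 c2 c3
      rw [apply_h φ, Fin.val_zero, h4 _ (by simp; omega)]
      rw [Nat.even_iff, Nat.even_iff]
      simp only
      omega

theorem boundaryEdge_injective {n : ℕ} : Function.Injective (boundaryEdge (n := n)) := by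
  rintro ⟨k, hk⟩ ⟨l, hl⟩ h
  unfold boundaryEdge at h
  simp only at h
  rw [Fin.mk.injEq]
  split_ifs at h <;> simp only [Edge.v.injEq, Edge.h.injEq, Fin.ext_iff, Fin.val_last,
    Fin.val_zero] at h <;> omega

/-- The boundary edge in position `t`, where positions are read modulo `4 n`. -/
def boundaryMod {n : ℕ} (hn : 0 < n) (t : ℕ) : Edge n :=
  boundaryEdge ⟨t % (4 * n), Nat.mod_lt _ (by omega)⟩

/-- The black boundary edge with label `i` at time `s`. Positions are shifted by the time, so that
the labels move along with the paths under a half-gyration. -/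
def leg {n : ℕ} (s : ℕ) (i : Fin (2 * n)) : Edge n :=
  boundaryEdge ⟨(2 * i.val + s) % (4 * n), Nat.mod_lt _ (by have := i.isLt; omega)⟩

theorem leg_zero {n : ℕ} (i : Fin (2 * n)) : leg 0 i = blackLeg i := by
  unfold leg blackLeg
  congr 2
  exact Nat.mod_eq_of_lt (by omega)

theorem even_mod_add {n t s : ℕ} : Even (t % (4 * n) + s) ↔ Even (t + s) := by
  have h := Nat.div_add_mod t (4 * n)
  rw [mul_assoc] at h
  generalize n * (t / (4 * n)) = m at h
  rw [Nat.even_iff, Nat.even_iff]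
  omega

theorem apply_boundaryMod {n : ℕ} (hn : 0 < n) {s : ℕ} {φ : Edge n → Bool} (h : BoundaryAt s φ)
    (t : ℕ) : φ (boundaryMod hn t) = true ↔ Even (t + s) := by
  rw [boundaryMod, h, even_mod_add]

theorem apply_leg {n : ℕ} {s : ℕ} {φ : Edge n → Bool} (h : BoundaryAt s φ)
    (i : Fin (2 * n)) : φ (leg s i) = true := by
  rw [leg, h, even_mod_add, Nat.even_iff]
  omega

theorem leg_injective {n : ℕ} (s : ℕ) : Function.Injective (leg (n := n) s) := by
  intro i j h
  have h := boundaryEdge_injective h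
  rw [Fin.mk.injEq] at h
  have h' : 2 * i.val ≡ 2 * j.val [MOD 4 * n] := Nat.ModEq.add_right_cancel' s h
  have := Nat.ModEq.eq_of_lt_of_lt h' (by omega) (by omega)
  exact Fin.ext (by omega)

/-- Every black boundary position carries a label. -/
theorem exists_leg_eq {n : ℕ} {s k : ℕ} (hk : k < 4 * n) (he : Even (k + s)) :
    ∃ i : Fin (2 * n), leg s i = boundaryEdge ⟨k, hk⟩ := by
  have h := Nat.div_add_mod s (4 * n)
  have hlt := Nat.mod_lt s (show 0 < 4 * n by omega)
  have hs : Even (k + s % (4 * n)) := by rw [add_comm, even_mod_add, add_comm]; exact he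
  rw [Nat.even_iff] at hs
  generalize hr : s % (4 * n) = r at *
  have key : ∀ i : Fin (2 * n), (2 * i.val + s) % (4 * n) = (2 * i.val + r) % (4 * n) := by
    intro i
    rw [← hr, Nat.add_mod_mod]
  by_cases hc : r ≤ k
  · refine ⟨⟨(k - r) / 2, by omega⟩, ?_⟩
    unfold leg
    congr 2
    rw [key]
    simp only
    rw [show 2 * ((k - r) / 2) + r = k by omega]
    exact Nat.mod_eq_of_lt hk
  · refine ⟨⟨(k + 4 * n - r) / 2, by omega⟩, ?_⟩
    unfold leg
    congr 2
    rw [key]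
    simp only
    rw [show 2 * ((k + 4 * n - r) / 2) + r = k + 4 * n by omega]
    rw [Nat.add_mod_right]
    exact Nat.mod_eq_of_lt hk

/-! ### The two-colouring of the faces by an even set of edges -/

/-- The parity of the number of edges of `C` crossed by a path of faces, from the bottom-left corner
up along the left side and then to the right, to the face whose upper right vertex is `(a, b)`.
Faces are indexed by `0 ≤ a, b ≤ n`; those with `a` or `b` in `{0, n}` are cut by the boundary. -/
def faceParity {n : ℕ} (C : Edge n → Bool) (a b : ℕ) : ZMod 2 :=
  ∑ y ∈ Finset.range b, ((hColor C 0 y).toNat : ZMod 2) +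
    ∑ x ∈ Finset.range a, ((vColor C x b).toNat : ZMod 2)

/-- Every vertex is adjacent to an even number of edges of `C`. -/
def EvenDegrees {n : ℕ} (C : Edge n → Bool) : Prop :=
  ∀ p : Fin n × Fin n, ∑ e ∈ incidentEdges p, ((C e).toNat : ZMod 2) = 0

theorem faceParity_right {n : ℕ} (C : Edge n → Bool) (a b : ℕ) :
    faceParity C (a + 1) b = faceParity C a b + (vColor C a b).toNat := by
  simp only [faceParity, Finset.sum_range_succ]
  ring

theorem faceParity_up {n : ℕ} {C : Edge n → Bool} (hC : EvenDegrees C) {a b : ℕ} (ha : a ≤ n)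
    (hb : b < n) : faceParity C a (b + 1) = faceParity C a b + (hColor C a b).toNat := by
  induction a with
  | zero => simp [faceParity, Finset.sum_range_succ]
  | succ a ih =>
    have h := hC (⟨a, ha⟩, ⟨b, hb⟩)
    rw [sum_incidentEdges] at h
    simp only [apply_h C, apply_v C, Fin.val_castSucc, Fin.val_succ] at h
    rw [faceParity_right, faceParity_right, ih (by omega)]
    have h2 : (2 : ZMod 2) = 0 := rfl
    linear_combination h - ((vColor C a b).toNat + (hColor C (a + 1) b).toNat : ZMod 2) * h2

/-- The boundary face between the boundary edges `k - 1` and `k`, with `k = 4 n` for the same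
face as `k = 0`. -/
def boundaryFace (n k : ℕ) : ℕ × ℕ :=
  if k < n then (k, 0)
  else if k < 2 * n then (n, k - n)
  else if k < 3 * n then (3 * n - k, n)
  else (0, 4 * n - k)

/-- The parity of the boundary face that precedes the boundary edge `k`. -/
def boundaryParity {n : ℕ} (C : Edge n → Bool) (k : ℕ) : ZMod 2 :=
  faceParity C (boundaryFace n k).1 (boundaryFace n k).2

theorem boundaryParity_succ {n : ℕ} {C : Edge n → Bool} (hC : EvenDegrees C) (k : Fin (4 * n)) :
    boundaryParity C (k.val + 1) = boundaryParity C k.val + ((C (boundaryEdge k)).toNat : ZMod 2) := by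
  obtain ⟨k, hk⟩ := k
  have h2 : (2 : ZMod 2) = 0 := rfl
  simp only [boundaryEdge]
  by_cases c1 : k < n
  · rw [dif_pos c1, apply_v C]
    have : boundaryParity C (k + 1) = faceParity C (k + 1) 0 := by
      unfold boundaryParity boundaryFace
      split_ifs <;> first | rfl | (exfalso; omega) | skip
      rw [show k + 1 = n by omega, Nat.sub_self]
    rw [this, faceParity_right]
    simp [boundaryParity, boundaryFace, c1]
  rw [dif_neg c1]
  by_cases c2 : k < 2 * n
  · rw [dif_pos c2, apply_h C]
    have : boundaryParity C (k + 1) = faceParity C n (k - n + 1) := by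
      unfold boundaryParity boundaryFace
      split_ifs <;> first | rfl | (exfalso; omega) | skip
      · rw [show k + 1 - n = k - n + 1 by omega]
      · rw [show 3 * n - (k + 1) = n by omega, show k - n + 1 = n by omega]
    rw [this, faceParity_up hC le_rfl (by omega)]
    simp [boundaryParity, boundaryFace, c1, c2]
  rw [dif_neg c2]
  by_cases c3 : k < 3 * n
  · rw [dif_pos c3, apply_v C]
    have : boundaryParity C (k + 1) = faceParity C (3 * n - 1 - k) n := by
      unfold boundaryParity boundaryFace
      split_ifs <;> first | rfl | (exfalso; omega) | skip
      · rw [show 3 * n - (k + 1) = 3 * n - 1 - k by omega]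
      · rw [show 4 * n - (k + 1) = n by omega, show 3 * n - 1 - k = 0 by omega]
    have h' := faceParity_right C (3 * n - 1 - k) n
    rw [show 3 * n - 1 - k + 1 = 3 * n - k by omega] at h'
    rw [this]
    simp only [boundaryParity, boundaryFace, if_neg c1, if_neg c2, if_pos c3, h', Fin.val_last]
    linear_combination -((vColor C (3 * n - 1 - k) n).toNat : ZMod 2) * h2
  · rw [dif_neg c3, apply_h C]
    have : boundaryParity C (k + 1) = faceParity C 0 (4 * n - 1 - k) := by
      unfold boundaryParity boundaryFace
      split_ifs <;> first | rfl | (exfalso; omega) | skip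
      rw [show 4 * n - (k + 1) = 4 * n - 1 - k by omega]
    have h' := faceParity_up hC (a := 0) (b := 4 * n - 1 - k) (by omega) (by omega)
    rw [show 4 * n - 1 - k + 1 = 4 * n - k by omega] at h'
    rw [this]
    simp only [boundaryParity, boundaryFace, if_neg c1, if_neg c2, if_neg c3, h', Fin.val_zero]
    linear_combination -((hColor C 0 (4 * n - 1 - k)).toNat : ZMod 2) * h2

theorem boundaryParity_period {n : ℕ} (C : Edge n → Bool) :
    boundaryParity C (4 * n) = boundaryParity C 0 := by
  unfold boundaryParity boundaryFace
  split_ifs <;> first | (exfalso; omega) | simp [show n = 0 by omega] | simp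

theorem boundaryParity_mod_succ {n : ℕ} (hn : 0 < n) {C : Edge n → Bool} (hC : EvenDegrees C)
    (t : ℕ) : boundaryParity C ((t + 1) % (4 * n)) =
      boundaryParity C (t % (4 * n)) + ((C (boundaryMod hn t)).toNat : ZMod 2) := by
  have h := boundaryParity_succ hC ⟨t % (4 * n), Nat.mod_lt _ (by omega)⟩
  simp only at h
  rw [boundaryMod, ← h, Nat.add_mod]
  have hlt := Nat.mod_lt t (show 0 < 4 * n by omega)
  rw [Nat.mod_eq_of_lt (show 1 < 4 * n by omega)]
  by_cases hc : t % (4 * n) + 1 = 4 * n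
  · rw [hc, Nat.mod_self, boundaryParity_period]
  · rw [Nat.mod_eq_of_lt (by omega)]

theorem boundaryParity_mod_const {n : ℕ} (hn : 0 < n) {C : Edge n → Bool} (hC : EvenDegrees C)
    {t u : ℕ} (htu : t ≤ u) (h : ∀ m, t ≤ m → m < u → C (boundaryMod hn m) = false) :
    boundaryParity C (u % (4 * n)) = boundaryParity C (t % (4 * n)) := by
  induction u, htu using Nat.le_induction with
  | base => rfl
  | succ u htu ih =>
    rw [boundaryParity_mod_succ hn hC, h u htu (by omega), ih fun m h1 h2 => h m h1 (by omega)]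
    simp

/-- The parity of the face on the left of a vertical edge, or below a horizontal one. -/
def sideParity {n : ℕ} (C : Edge n → Bool) : Edge n → ZMod 2
  | Edge.h x y => faceParity C x y
  | Edge.v x y => faceParity C x y

theorem sideParity_boundaryEdge {n : ℕ} {C : Edge n → Bool} (hC : EvenDegrees C) (k : Fin (4 * n))
    (hk : C (boundaryEdge k) = false) :
    sideParity C (boundaryEdge k) = boundaryParity C k := by
  have hs := boundaryParity_succ hC k
  rw [hk] at hs
  obtain ⟨k, hlt⟩ := k
  simp only [boundaryEdge] at hk ⊢
  split_ifs with c1 c2 c3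
  · simp [sideParity, boundaryParity, boundaryFace, c1]
  · simp [sideParity, boundaryParity, boundaryFace, c1, c2]
  · simp only [Bool.toNat_false, Nat.cast_zero, add_zero] at hs
    rw [← hs]
    simp only [sideParity, boundaryParity, boundaryFace, Fin.val_last]
    split_ifs <;> first | (exfalso; omega) | skip
    · rw [show 3 * n - (k + 1) = 3 * n - 1 - k by omega]
    · rw [show 4 * n - (k + 1) = n by omega, show 3 * n - 1 - k = 0 by omega]
  · simp only [Bool.toNat_false, Nat.cast_zero, add_zero] at hs
    rw [← hs]
    simp only [sideParity, boundaryParity, boundaryFace, Fin.val_zero]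
    split_ifs <;> first | (exfalso; omega) | skip
    rw [show 4 * n - (k + 1) = 4 * n - 1 - k by omega]

theorem sideParity_eq {n : ℕ} {C : Edge n → Bool} (hC : EvenDegrees C) {p : Fin n × Fin n}
    (hp : ∀ e ∈ incidentEdges p, C e = false) {e : Edge n} (he : e ∈ incidentEdges p) :
    sideParity C e = faceParity C p.1 p.2 := by
  have hl : hColor C p.1 p.2 = false := by
    have := hp (Edge.h p.1.castSucc p.2) (by simp [incidentEdges])
    rwa [apply_h C] at this
  have hb : vColor C p.1 p.2 = false := by
    have := hp (Edge.v p.1 p.2.castSucc) (by simp [incidentEdges])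
    rwa [apply_v C] at this
  have h1 := faceParity_right C p.1 p.2
  have h2 := faceParity_up hC p.1.2.le p.2.2
  rw [hb] at h1
  rw [hl] at h2
  cases e with
  | h x y =>
    obtain ⟨hx | hx, hy⟩ := h_mem_incidentEdges.1 he
    · simp [sideParity, hx, hy]
    · simp [sideParity, hx, hy, h1]
  | v x y =>
    obtain ⟨hx, hy | hy⟩ := v_mem_incidentEdges.1 he
    · simp [sideParity, hx, hy]
    · simp [sideParity, hx, hy, h2]

/-! ### Components of black edges -/

theorem IceRule.eq_or_eq {n : ℕ} {φ : Edge n → Bool} (h : IceRule φ) {p : Fin n × Fin n}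
    {e f g : Edge n} (he : e ∈ incidentEdges p) (hf : f ∈ incidentEdges p)
    (hg : g ∈ incidentEdges p) (be : φ e = true) (bf : φ f = true) (bg : φ g = true)
    (hef : e ≠ f) : g = e ∨ g = f := by
  by_contra! hc
  have := (h p).1
  have h3 : 2 < ((incidentEdges p).filter (fun e => φ e = true)).card :=
    Finset.two_lt_card.2 ⟨e, by simp [he, be], f, by simp [hf, bf], g, by simp [hg, bg],
      hef, hc.1.symm, hc.2.symm⟩
  omega

theorem reachable_black {n : ℕ} {φ : Edge n → Bool} {e f : Edge n}
    (h : (blackGraph φ).Reachable e f) (he : φ e = true) : φ f = true := by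
  rw [SimpleGraph.reachable_iff_reflTransGen] at h
  induction h with
  | refl => exact he
  | tail _ hadj _ => exact hadj.2.2.1

theorem reachable_of_mem {n : ℕ} {φ : Edge n → Bool} {e f : Edge n} {p : Fin n × Fin n}
    (he : e ∈ incidentEdges p) (hf : f ∈ incidentEdges p) (be : φ e = true) (bf : φ f = true) :
    (blackGraph φ).Reachable e f := by
  by_cases hef : e = f
  · rw [hef]
  · exact SimpleGraph.Adj.reachable ⟨hef, be, bf, p, he, hf⟩

open Classical in
/-- The indicator function of the black path or cycle through `e`. -/
noncomputable def component {n : ℕ} (φ : Edge n → Bool) (e f : Edge n) : Bool :=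
  decide ((blackGraph φ).Reachable e f)

theorem component_eq_true {n : ℕ} {φ : Edge n → Bool} {e f : Edge n} :
    component φ e f = true ↔ (blackGraph φ).Reachable e f := by
  simp [component]

theorem component_eq_false {n : ℕ} {φ : Edge n → Bool} {e f : Edge n} :
    component φ e f = false ↔ ¬ (blackGraph φ).Reachable e f := by
  simp [component]

/-- A black path uses both black edges of each vertex that it visits. -/
theorem evenDegrees_component {n : ℕ} {φ : Edge n → Bool} (h : IceRule φ) {e : Edge n}
    (he : φ e = true) : EvenDegrees (component φ e) := by
  intro p
  by_cases hc : ∃ f ∈ incidentEdges p, component φ e f = true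
  · obtain ⟨f, hf, hcf⟩ := hc
    rw [component_eq_true] at hcf
    have bf := reachable_black hcf he
    have : ∀ g ∈ incidentEdges p, component φ e g = φ g := by
      intro g hg
      by_cases bg : φ g = true
      · rw [bg, component_eq_true]
        exact hcf.trans (reachable_of_mem hf hg bf bg)
      · rw [Bool.not_eq_true] at bg
        rw [bg, component_eq_false]
        intro hr
        rw [reachable_black hr he] at bg
        cases bg
    rw [Finset.sum_congr rfl fun g hg => by rw [this g hg]]
    have h2 := (h p).1
    rw [Finset.card_filter] at h2
    rw [← Nat.cast_sum]
    have : ∑ g ∈ incidentEdges p, (φ g).toNat = 2 := by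
      rw [← h2]
      refine Finset.sum_congr rfl fun g _ => ?_
      cases φ g <;> rfl
    rw [this]
    rfl
  · push Not at hc
    refine Finset.sum_eq_zero fun g hg => ?_
    have := hc g hg
    simp [Bool.eq_false_iff.2 this]

/-- A black path stays on one side of every other black path. -/
theorem sideParity_eq_of_reachable {n : ℕ} {φ : Edge n → Bool} (h : IceRule φ) {e f g : Edge n}
    (he : φ e = true) (hef : ¬ (blackGraph φ).Reachable e f)
    (hfg : (blackGraph φ).Reachable f g) :
    sideParity (component φ e) f = sideParity (component φ e) g := by
  have hC := evenDegrees_component h he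
  rw [SimpleGraph.reachable_iff_reflTransGen] at hfg
  induction hfg with
  | refl => rfl
  | @tail g k hfg hadj ih =>
    rw [ih]
    rw [← SimpleGraph.reachable_iff_reflTransGen] at hfg
    obtain ⟨hne, bg, bk, p, hg, hk⟩ := hadj
    have hgk := reachable_of_mem hg hk bg bk
    have hp : ∀ q ∈ incidentEdges p, component φ e q = false := by
      intro q hq
      rw [component_eq_false]
      intro hr
      rcases h.eq_or_eq hg hk hq bg bk (reachable_black hr he) hne with rfl | rfl
      · exact hef (hr.trans hfg.symm)
      · exact hef (hr.trans (hfg.trans hgk).symm)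
    rw [sideParity_eq hC hp hg, sideParity_eq hC hp hk]

/-- The end vertices of an edge. -/
def endpoints {n : ℕ} (e : Edge n) : Finset (Fin n × Fin n) :=
  Finset.univ.filter fun p => e ∈ incidentEdges p

theorem card_endpoints_le {n : ℕ} (e : Edge n) : (endpoints e).card ≤ 2 := by
  by_contra! hc
  obtain ⟨p, hp, q, hq, r, hr, hpq, hpr, hqr⟩ := Finset.two_lt_card.1 hc
  simp only [endpoints, Finset.mem_filter, Finset.mem_univ, true_and] at hp hq hr
  cases e with
  | h x y =>
    rw [h_mem_incidentEdges] at hp hq hr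
    rw [Ne, Prod.ext_iff, Fin.ext_iff, Fin.ext_iff] at hpq hpr hqr
    omega
  | v x y =>
    rw [v_mem_incidentEdges] at hp hq hr
    rw [Ne, Prod.ext_iff, Fin.ext_iff, Fin.ext_iff] at hpq hpr hqr
    omega

theorem card_endpoints_boundaryEdge {n : ℕ} (k : Fin (4 * n)) :
    (endpoints (boundaryEdge k)).card ≤ 1 := by
  refine Finset.card_le_one.2 fun p hp q hq => ?_
  simp only [endpoints, Finset.mem_filter, Finset.mem_univ, true_and] at hp hq
  have := p.1.2
  have := p.2.2
  have := q.1.2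
  have := q.2.2
  rw [Prod.ext_iff, Fin.ext_iff, Fin.ext_iff]
  unfold boundaryEdge at hp hq
  split_ifs at hp hq <;>
    simp only [h_mem_incidentEdges, v_mem_incidentEdges, Fin.val_zero, Fin.val_last] at hp hq <;>
    omega

open Classical in
theorem card_neighbors_le {n : ℕ} {φ : Edge n → Bool} (h : IceRule φ) (e : Edge n) :
    (Finset.univ.filter ((blackGraph φ).Adj e)).card ≤ (endpoints e).card := by
  have hex : ∀ f ∈ Finset.univ.filter ((blackGraph φ).Adj e), ∃ p, e ∈ incidentEdges p ∧
      f ∈ incidentEdges p := by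
    intro f hf
    rw [Finset.mem_filter] at hf
    exact hf.2.2.2.2
  rcases (Finset.univ.filter ((blackGraph φ).Adj e)).eq_empty_or_nonempty with hemp | ⟨f₀, hf₀⟩
  · simp [hemp]
  have : Nonempty (Fin n × Fin n) := ⟨(hex f₀ hf₀).choose⟩
  choose! P hP using hex
  refine Finset.card_le_card_of_injOn P (fun f hf => ?_) (fun f hf g hg hfg => ?_)
  · simpa [endpoints] using (hP f hf).1
  · have h1 := hP f hf
    have h2 := hP g hg
    simp only [Finset.coe_filter, Finset.mem_univ, true_and, Set.mem_ofPred_eq] at hf hg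
    rw [← hfg] at h2
    rcases h.eq_or_eq h1.1 h1.2 h2.2 hf.2.1 hf.2.2.1 hg.2.2.1 hf.1 with hgf | hgf
    · exact absurd hgf hg.1.symm
    · exact hgf.symm

open Classical in
/-- A component of black edges contains at most two boundary edges: it is connected, its nodes have
degree at most `2`, and boundary edges have degree at most `1`. -/
theorem not_three_boundary_reachable {n : ℕ} {φ : Edge n → Bool} (h : IceRule φ)
    {i j k : Fin (4 * n)} (hij : i ≠ j) (hik : i ≠ k) (hjk : j ≠ k)
    (rj : (blackGraph φ).Reachable (boundaryEdge i) (boundaryEdge j))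
    (rk : (blackGraph φ).Reachable (boundaryEdge i) (boundaryEdge k)) : False := by
  set C := (blackGraph φ).connectedComponentMk (boundaryEdge i) with hC
  have mi : boundaryEdge i ∈ C := SimpleGraph.ConnectedComponent.connectedComponentMk_mem
  have mj : boundaryEdge j ∈ C := SimpleGraph.ConnectedComponent.eq.2 rj.symm
  have mk : boundaryEdge k ∈ C := SimpleGraph.ConnectedComponent.eq.2 rk.symm
  have hconn := C.connected_toSimpleGraph
  have h1 := hconn.card_vert_le_card_edgeSet_add_one
  have h2 := SimpleGraph.sum_degrees_eq_twice_card_edges C.toSimpleGraph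
  rw [Nat.card_eq_fintype_card, Nat.card_eq_fintype_card, ← SimpleGraph.edgeFinset_card] at h1
  have hdeg : ∀ e : C, C.toSimpleGraph.degree e ≤ (endpoints e.1).card := by
    intro e
    refine le_trans ?_ (card_neighbors_le h e.1)
    rw [← SimpleGraph.card_neighborFinset_eq_degree]
    refine Finset.card_le_card_of_injOn Subtype.val (fun f hf => ?_)
      Subtype.val_injective.injOn
    simp only [Finset.mem_coe, SimpleGraph.mem_neighborFinset] at hf
    rw [Finset.mem_coe, Finset.mem_filter]
    exact ⟨Finset.mem_univ _, hf⟩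
  let S : Finset C := {⟨boundaryEdge i, mi⟩, ⟨boundaryEdge j, mj⟩, ⟨boundaryEdge k, mk⟩}
  have hS : S.card = 3 := by
    refine Finset.card_eq_three.2 ⟨_, _, _, ?_, ?_, ?_, rfl⟩ <;>
      simp [boundaryEdge_injective.eq_iff, hij, hik, hjk]
  have hb : ∀ e : C, (endpoints e.1).card + (if e ∈ S then 1 else 0) ≤ 2 := by
    intro e
    split_ifs with he
    · simp only [S, Finset.mem_insert, Finset.mem_singleton] at he
      rcases he with rfl | rfl | rfl <;>
        exact Nat.add_le_add_right (card_endpoints_boundaryEdge _) 1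
    · exact card_endpoints_le _
  have h3 : ∑ e : C, ((endpoints e.1).card + (if e ∈ S then 1 else 0)) ≤ ∑ e : C, 2 :=
    Finset.sum_le_sum fun e _ => hb e
  rw [Finset.sum_add_distrib, ← Finset.card_filter, Finset.filter_univ_mem, hS] at h3
  have h4 : ∑ e : C, C.toSimpleGraph.degree e ≤ ∑ e : C, (endpoints e.1).card :=
    Finset.sum_le_sum fun e _ => hdeg e
  simp only [Finset.sum_const, Finset.card_univ, smul_eq_mul] at h3
  omega

/-! ### Every configuration has a link pattern -/

/-- `π` is the link pattern of the colouring `φ` with the labels of time `s`. -/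
def PatternAt {n : ℕ} (s : ℕ) (φ : Edge n → Bool) (π : LinkPattern n) : Prop :=
  ∀ i j : Fin (2 * n), i ≠ j → (π.1 i = j ↔ (blackGraph φ).Reachable (leg s i) (leg s j))

theorem eq_of_mod_eq {N a b : ℕ} (h : a % N = b % N) (h1 : a < b + N) (h2 : b < a + N) :
    a = b := by
  have hd : (N : ℤ) ∣ (b : ℤ) - a := (Nat.modEq_iff_dvd (n := N)).1 h
  have := Int.eq_zero_of_abs_lt_dvd hd (by rw [abs_lt]; omega)
  omega

/-- The boundary edges in the component of a black boundary edge are black as well, hence carry a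
label. -/
theorem exists_label_of_component {n : ℕ} (hn : 0 < n) {s : ℕ} {φ : Edge n → Bool}
    (hb : BoundaryAt s φ) {i : Fin (2 * n)} {m : ℕ}
    (h : component φ (leg s i) (boundaryMod hn m) = true) :
    ∃ j : Fin (2 * n), (blackGraph φ).Reachable (leg s i) (leg s j) ∧
      (2 * j.val + s) % (4 * n) = m % (4 * n) := by
  rw [component_eq_true] at h
  have bm := reachable_black h (apply_leg hb i)
  rw [apply_boundaryMod hn hb, ← even_mod_add (n := n)] at bm
  obtain ⟨j, hj⟩ := exists_leg_eq (Nat.mod_lt m (show 0 < 4 * n by omega)) bm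
  refine ⟨j, ?_, ?_⟩
  · rw [hj]
    exact h
  · simpa using boundaryEdge_injective hj

/-- Since the parity of the boundary faces returns to its value after a full turn, the component of
a black boundary edge contains another one. -/
theorem exists_reachable_leg {n : ℕ} {s : ℕ} {φ : Edge n → Bool} (hi : IceRule φ)
    (hb : BoundaryAt s φ) (i : Fin (2 * n)) :
    ∃ j, j ≠ i ∧ (blackGraph φ).Reachable (leg s i) (leg s j) := by
  have hn : 0 < n := by have := i.isLt; omega
  by_contra! hc
  have hC := evenDegrees_component hi (apply_leg hb i)
  have h1 := boundaryParity_mod_const hn hC (t := 2 * i.val + s + 1) (u := 2 * i.val + s + 4 * n)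
    (by omega) (by
      intro m hm1 hm2
      by_contra! hcm
      rw [ne_eq, Bool.not_eq_false] at hcm
      obtain ⟨j, hj, hjm⟩ := exists_label_of_component hn hb hcm
      by_cases hji : j = i
      · rw [hji] at hjm
        have := eq_of_mod_eq hjm (by omega) (by omega)
        omega
      · exact hc j hji hj)
  rw [boundaryParity_mod_succ hn hC, Nat.add_mod_right] at h1
  have h2 : component φ (leg s i) (boundaryMod hn (2 * i.val + s)) = true :=
    component_eq_true.2 (SimpleGraph.Reachable.refl _)
  rw [h2] at h1
  simp at h1

theorem leg_reachable_unique {n : ℕ} {s : ℕ} {φ : Edge n → Bool} (hi : IceRule φ)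
    {i j k : Fin (2 * n)} (hij : j ≠ i) (hik : k ≠ i)
    (hj : (blackGraph φ).Reachable (leg s i) (leg s j))
    (hk : (blackGraph φ).Reachable (leg s i) (leg s k)) : j = k := by
  by_contra hjk
  have hinj : ∀ a b : Fin (2 * n), a ≠ b →
      (⟨(2 * a.val + s) % (4 * n), Nat.mod_lt _ (by have := a.isLt; omega)⟩ : Fin (4 * n)) ≠
      ⟨(2 * b.val + s) % (4 * n), Nat.mod_lt _ (by have := a.isLt; omega)⟩ := by
    intro a b hab h
    exact hab (leg_injective s (congrArg boundaryEdge h))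
  exact not_three_boundary_reachable hi (hinj _ _ hij.symm) (hinj _ _ hik.symm) (hinj _ _ hjk) hj hk

theorem exists_patternAt {n : ℕ} {s : ℕ} {φ : Edge n → Bool} (hi : IceRule φ)
    (hb : BoundaryAt s φ) : ∃ π : LinkPattern n, PatternAt s φ π := by
  choose f hne hf using exists_reachable_leg hi hb
  have hinv : ∀ i, f (f i) = i := fun i =>
    leg_reachable_unique hi (hne (f i)) (hne i).symm (hf (f i)) (hf i).symm
  refine ⟨⟨f, hinv, hne, ?_⟩, ?_⟩
  · rintro i j ⟨hij, hjk, hkl⟩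
    have hn : 0 < n := by have := i.isLt; omega
    rw [Fin.lt_def] at hij hjk hkl
    have hC := evenDegrees_component hi (apply_leg hb i)
    have hout : ∀ m, 2 * i.val + s < m → m < 2 * i.val + s + 4 * n → m ≠ 2 * (f i).val + s →
        component φ (leg s i) (boundaryMod hn m) = false := by
      intro m h1 h2 h3
      by_contra! hcm
      rw [ne_eq, Bool.not_eq_false] at hcm
      obtain ⟨k, hk, hkm⟩ := exists_label_of_component hn hb hcm
      have hk' := k.isLt
      by_cases hki : k = i
      · rw [hki] at hkm
        have := eq_of_mod_eq hkm (by omega) (by omega)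
        omega
      · have hkf := leg_reachable_unique hi hki (hne i) hk (hf i)
        rw [hkf] at hkm
        have := (f i).isLt
        have := eq_of_mod_eq hkm (by omega) (by omega)
        omega
    have hl := (f j).isLt
    have h1 := boundaryParity_mod_const hn hC (t := 2 * j.val + s) (u := 2 * (f i).val + s)
      (by omega) fun m h1 h2 => hout m (by omega) (by omega) (by omega)
    have h2 := boundaryParity_mod_const hn hC (t := 2 * (f i).val + s + 1)
      (u := 2 * (f j).val + s)
      (by omega) fun m h1 h2 => hout m (by omega) (by omega) (by omega)
    have h3 := boundaryParity_mod_succ hn hC (2 * (f i).val + s)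
    have h4 : component φ (leg s i) (boundaryMod hn (2 * (f i).val + s)) = true :=
      component_eq_true.2 (hf i)
    have oj := hout (2 * j.val + s) (by omega) (by omega) (by omega)
    have ol := hout (2 * (f j).val + s) (by omega) (by omega) (by omega)
    have h5 := sideParity_eq_of_reachable hi (apply_leg hb i)
      (component_eq_false.1 oj) (hf j)
    have h6 := sideParity_boundaryEdge hC _ oj
    have h7 := sideParity_boundaryEdge hC _ ol
    rw [h4, h1, ← h2] at h3
    have h8 := (h6.symm.trans h5).trans h7
    simp only at h8
    rw [← h8] at h3
    simp at h3
  · intro i j hij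
    constructor
    · rintro rfl
      exact hf i
    · intro h
      exact leg_reachable_unique hi (hne i) hij.symm (hf i) h

theorem PatternAt.unique {n : ℕ} {s : ℕ} {φ : Edge n → Bool} {π ρ : LinkPattern n}
    (h : PatternAt s φ π) (h' : PatternAt s φ ρ) : π = ρ := by
  refine Subtype.ext (funext fun i => ?_)
  have hne : i ≠ π.1 i := (π.2.2.1 i).symm
  exact ((h' _ _ hne).2 ((h _ _ hne).1 rfl)).symm

/-- To identify the link pattern it suffices to exhibit its connections. -/
theorem PatternAt.eq_of_reachable {n : ℕ} {s : ℕ} {φ : Edge n → Bool} {π ρ : LinkPattern n}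
    (h : PatternAt s φ π)
    (h' : ∀ i, (blackGraph φ).Reachable (leg s i) (leg s (ρ.1 i))) : π = ρ :=
  Subtype.ext (funext fun i => (h _ _ (ρ.2.2.1 i).symm).2 (h' i))

theorem PatternAt.reachable {n : ℕ} {s : ℕ} {φ : Edge n → Bool} {π : LinkPattern n}
    (h : PatternAt s φ π) (i : Fin (2 * n)) :
    (blackGraph φ).Reachable (leg s i) (leg s (π.1 i)) :=
  (h _ _ (π.2.2.1 i).symm).1 rfl

/-- The configurations at time `s`. -/
abbrev Config (n s : ℕ) : Type :=
  {φ : Edge n → Bool // IceRule φ ∧ BoundaryAt s φ}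

noncomputable instance (n s : ℕ) : Fintype (Config n s) := Fintype.ofFinite _

/-- The link pattern of a configuration. -/
noncomputable def linkPattern {n s : ℕ} (φ : Config n s) : LinkPattern n :=
  (exists_patternAt φ.2.1 φ.2.2).choose

theorem patternAt_linkPattern {n s : ℕ} (φ : Config n s) : PatternAt s φ.1 (linkPattern φ) :=
  (exists_patternAt φ.2.1 φ.2.2).choose_spec

/-! ### The half-gyration -/

/-- The face `(a, b)` is a full square whose four edges alternate in colour. -/
def Alternating {n : ℕ} (φ : Edge n → Bool) (a b : ℕ) : Prop :=
  1 ≤ a ∧ a < n ∧ 1 ≤ b ∧ b < n ∧ hColor φ a (b - 1) = hColor φ a b ∧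
    vColor φ (a - 1) b = vColor φ a b ∧ hColor φ a b ≠ vColor φ a b

instance {n : ℕ} (φ : Edge n → Bool) (a b : ℕ) : Decidable (Alternating φ a b) := by
  unfold Alternating; infer_instance

/-- The face `(a, b)` with `a + b + s` odd to which an edge belongs. -/
def face {n : ℕ} (s : ℕ) : Edge n → ℕ × ℕ
  | Edge.h x y => if Even (x.val + y.val + s) then (x, y + 1) else (x, y)
  | Edge.v x y => if Even (x.val + y.val + s) then (x + 1, y) else (x, y)

/-- The half-gyration at time `s`: the colours of the edges are inverted, except on the faces
`(a, b)` with `a + b + s` odd that alternate in colour. -/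
def gyration {n : ℕ} (s : ℕ) (φ : Edge n → Bool) (e : Edge n) : Bool :=
  if Alternating φ (face s e).1 (face s e).2 then φ e else !φ e

theorem hColor_gyration {n : ℕ} (s : ℕ) (φ : Edge n → Bool) {x y : ℕ} (hx : x ≤ n) (hy : y < n) :
    hColor (gyration s φ) x y =
      if Even (x + y + s) then (if Alternating φ x (y + 1) then hColor φ x y else !hColor φ x y)
      else (if Alternating φ x y then hColor φ x y else !hColor φ x y) := by
  have h := apply_h (gyration s φ) ⟨x, by omega⟩ ⟨y, hy⟩
  simp only at h
  rw [← h]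
  simp only [gyration, face, apply_h]
  by_cases hp : Even (x + y + s) <;> simp [hp]

theorem vColor_gyration {n : ℕ} (s : ℕ) (φ : Edge n → Bool) {x y : ℕ} (hx : x < n) (hy : y ≤ n) :
    vColor (gyration s φ) x y =
      if Even (x + y + s) then (if Alternating φ (x + 1) y then vColor φ x y else !vColor φ x y)
      else (if Alternating φ x y then vColor φ x y else !vColor φ x y) := by
  have h := apply_v (gyration s φ) ⟨x, hx⟩ ⟨y, by omega⟩
  simp only at h
  rw [← h]
  simp only [gyration, face, apply_v]
  by_cases hp : Even (x + y + s) <;> simp [hp]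

theorem not_even_face {n : ℕ} (s : ℕ) (e : Edge n) :
    ¬ Even ((face s e).1 + (face s e).2 + s) := by
  cases e with
  | h x y => simp only [face, Nat.even_iff]; split_ifs <;> simp only <;> omega
  | v x y => simp only [face, Nat.even_iff]; split_ifs <;> simp only <;> omega

theorem alternating_gyration {n : ℕ} {s : ℕ} {φ : Edge n → Bool} {a b : ℕ}
    (h : ¬ Even (a + b + s)) : Alternating (gyration s φ) a b ↔ Alternating φ a b := by
  by_cases hf : 1 ≤ a ∧ a < n ∧ 1 ≤ b ∧ b < n
  · obtain ⟨h1, h2, h3, h4⟩ := hf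
    have p1 : Even (a + (b - 1) + s) := by rw [Nat.even_iff] at *; omega
    have p2 : Even (a - 1 + b + s) := by rw [Nat.even_iff] at *; omega
    have e1 := hColor_gyration s φ (x := a) (y := b) (by omega) (by omega)
    have e2 := hColor_gyration s φ (x := a) (y := b - 1) (by omega) (by omega)
    have e3 := vColor_gyration s φ (x := a) (y := b) (by omega) (by omega)
    have e4 := vColor_gyration s φ (x := a - 1) (y := b) (by omega) (by omega)
    rw [if_neg h] at e1 e3
    rw [if_pos p1, show b - 1 + 1 = b by omega] at e2
    rw [if_pos p2, show a - 1 + 1 = a by omega] at e4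
    by_cases hA : Alternating φ a b
    · simp only [hA, if_true] at e1 e2 e3 e4
      simp only [Alternating, e1, e2, e3, e4]
    · simp only [hA, if_false] at e1 e2 e3 e4
      simp only [Alternating, e1, e2, e3, e4, ne_eq, Bool.not_inj_iff]
  · constructor <;> intro hA <;> exact absurd ⟨hA.1, hA.2.1, hA.2.2.1, hA.2.2.2.1⟩ hf

theorem gyration_gyration {n : ℕ} (s : ℕ) (φ : Edge n → Bool) :
    gyration s (gyration s φ) = φ := by
  funext e
  rw [gyration]
  simp only [alternating_gyration (not_even_face s e)]
  rw [gyration]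
  split_ifs <;> simp

/-- The two edges of a face at a vertex are either both inverted, or they differ in colour and their
colours are kept or exchanged; so the number of black edges at the vertex remains `2`. -/
theorem iceRule_gyration {n : ℕ} (s : ℕ) {φ : Edge n → Bool} (h : IceRule φ) :
    IceRule (gyration s φ) := by
  rw [iceRule_iff] at h ⊢
  intro x y hx hy
  have h0 := h x y hx hy
  rw [hColor_gyration s φ hx.le hy, hColor_gyration s φ hx hy, vColor_gyration s φ hx hy.le,
    vColor_gyration s φ hx hy]
  by_cases hp : Even (x + y + s)
  · have hp1 : ¬ Even (x + 1 + y + s) := by rw [Nat.even_iff] at *; omega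
    have hp2 : ¬ Even (x + (y + 1) + s) := by rw [Nat.even_iff] at *; omega
    rw [if_pos hp, if_neg hp1, if_pos hp, if_neg hp2]
    have a1 : Alternating φ x (y + 1) → hColor φ x y ≠ vColor φ x (y + 1) := by
      rintro ⟨-, -, -, -, e1, -, e2⟩
      rw [Nat.add_sub_cancel] at e1
      rwa [e1]
    have a2 : Alternating φ (x + 1) y → hColor φ (x + 1) y ≠ vColor φ x y := by
      rintro ⟨-, -, -, -, -, e1, e2⟩
      rw [Nat.add_sub_cancel] at e1
      rwa [e1]
    revert h0 a1 a2
    by_cases A1 : Alternating φ x (y + 1) <;> by_cases A2 : Alternating φ (x + 1) y <;>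
      simp only [A1, A2] <;>
      cases hColor φ x y <;> cases hColor φ (x + 1) y <;> cases vColor φ x y <;>
      cases vColor φ x (y + 1) <;> simp
  · have hp1 : Even (x + 1 + y + s) := by rw [Nat.even_iff] at *; omega
    have hp2 : Even (x + (y + 1) + s) := by rw [Nat.even_iff] at *; omega
    rw [if_neg hp, if_pos hp1, if_neg hp, if_pos hp2]
    have a1 : Alternating φ x y → hColor φ x y ≠ vColor φ x y := by
      rintro ⟨-, -, -, -, -, -, e2⟩
      exact e2
    have a2 : Alternating φ (x + 1) (y + 1) → hColor φ (x + 1) y ≠ vColor φ x (y + 1) := by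
      rintro ⟨-, -, -, -, e1, e2, e3⟩
      rw [Nat.add_sub_cancel] at e1 e2
      rwa [e1, e2]
    revert h0 a1 a2
    by_cases A1 : Alternating φ x y <;> by_cases A2 : Alternating φ (x + 1) (y + 1) <;>
      simp only [A1, A2] <;>
      cases hColor φ x y <;> cases hColor φ (x + 1) y <;> cases vColor φ x y <;>
      cases vColor φ x (y + 1) <;> simp

theorem face_boundaryEdge {n : ℕ} (s : ℕ) (k : Fin (4 * n)) :
    face s (boundaryEdge k) = boundaryFace n (if Even (k.val + s) then k.val + 1 else k.val) := by
  obtain ⟨k, hk⟩ := k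
  simp only [boundaryEdge]
  by_cases hp : Even (k + s)
  · rw [if_pos hp]
    rw [Nat.even_iff] at hp
    split_ifs <;> simp only [face, boundaryFace, Nat.even_iff, Fin.val_last, Fin.val_zero] <;>
      split_ifs <;> simp only [Prod.mk.injEq, true_and, and_true] <;> omega
  · rw [if_neg hp]
    rw [Nat.even_iff] at hp
    split_ifs <;> simp only [face, boundaryFace, Nat.even_iff, Fin.val_last, Fin.val_zero] <;>
      split_ifs <;> simp only [Prod.mk.injEq, true_and, and_true] <;> omega

theorem not_alternating_boundaryFace {n : ℕ} (φ : Edge n → Bool) (k : ℕ) :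
    ¬ Alternating φ (boundaryFace n k).1 (boundaryFace n k).2 := by
  rintro ⟨h1, h2, h3, h4, -⟩
  unfold boundaryFace at *
  split_ifs at * <;> simp only at * <;> omega

theorem not_alternating_face_boundaryEdge {n : ℕ} (φ : Edge n → Bool) (s : ℕ) (k : Fin (4 * n)) :
    ¬ Alternating φ (face s (boundaryEdge k)).1 (face s (boundaryEdge k)).2 := by
  rw [face_boundaryEdge]
  exact not_alternating_boundaryFace φ _

theorem boundaryAt_gyration {n : ℕ} {s : ℕ} {φ : Edge n → Bool} (t : ℕ) (h : BoundaryAt s φ) :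
    BoundaryAt (s + 1) (gyration t φ) := by
  intro k
  rw [gyration, if_neg (not_alternating_face_boundaryEdge φ t k), Bool.not_eq_true',
    ← Bool.not_eq_true, h k, Nat.even_iff, Nat.even_iff]
  omega

theorem boundaryAt_congr {n : ℕ} {s t : ℕ} (hst : Even (s + t)) {φ : Edge n → Bool} :
    BoundaryAt s φ ↔ BoundaryAt t φ := by
  refine forall_congr' fun k => ?_
  have : Even (k.val + s) ↔ Even (k.val + t) := by
    rw [Nat.even_iff] at *
    rw [Nat.even_iff]
    omega
  rw [this]

theorem face_boundaryMod_succ {n : ℕ} (hn : 0 < n) {s t : ℕ} (h : Even (t + s)) :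
    face s (boundaryMod hn (t + 1)) = face s (boundaryMod hn t) := by
  have h1 : Even (t % (4 * n) + s) := even_mod_add.2 h
  have h2 : ¬ Even ((t + 1) % (4 * n) + s) := by
    rw [even_mod_add, Nat.even_iff] at *
    omega
  rw [boundaryMod, boundaryMod, face_boundaryEdge, face_boundaryEdge]
  simp only
  rw [if_pos h1, if_neg h2, Nat.add_mod, Nat.mod_eq_of_lt (show 1 < 4 * n by omega)]
  have hlt := Nat.mod_lt t (show 0 < 4 * n by omega)
  by_cases hc : t % (4 * n) + 1 = 4 * n
  · rw [hc, Nat.mod_self]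
    unfold boundaryFace
    split_ifs <;> first | (exfalso; omega) | simp
  · rw [Nat.mod_eq_of_lt (by omega)]

/-! ### The half-gyration preserves the connections -/

theorem Alternating.apply_h {n : ℕ} {φ : Edge n → Bool} {s : ℕ} {x : Fin (n + 1)} {y : Fin n}
    {a b : ℕ} (h : Alternating φ a b) (hf : face s (Edge.h x y) = (a, b)) :
    φ (Edge.h x y) = hColor φ a b := by
  obtain ⟨-, -, -, -, h1, -, -⟩ := h
  simp only [face] at hf
  rw [_root_.apply_h φ]
  split_ifs at hf <;> obtain ⟨rfl, rfl⟩ := Prod.mk.inj hf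
  · exact h1
  · rfl

theorem Alternating.apply_v {n : ℕ} {φ : Edge n → Bool} {s : ℕ} {x : Fin n} {y : Fin (n + 1)}
    {a b : ℕ} (h : Alternating φ a b) (hf : face s (Edge.v x y) = (a, b)) :
    φ (Edge.v x y) = vColor φ a b := by
  obtain ⟨-, -, -, -, -, h1, -⟩ := h
  simp only [face] at hf
  rw [_root_.apply_v φ]
  split_ifs at hf <;> obtain ⟨rfl, rfl⟩ := Prod.mk.inj hf
  · exact h1
  · rfl

/-- Two edges of an alternating face that share a vertex have different colours. -/
theorem Alternating.apply_ne {n : ℕ} {φ : Edge n → Bool} {s : ℕ} {e f : Edge n} {p : Fin n × Fin n}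
    (h : Alternating φ (face s e).1 (face s e).2) (hf : face s f = face s e)
    (he : e ∈ incidentEdges p) (hfp : f ∈ incidentEdges p) (hne : e ≠ f) : φ e ≠ φ f := by
  have hd := h.2.2.2.2.2.2
  cases e with
  | h x y =>
    cases f with
    | h x' y' =>
      rw [h_mem_incidentEdges] at he hfp
      rw [ne_eq, Edge.h.injEq, Fin.ext_iff, Fin.ext_iff] at hne
      simp only [face, Nat.even_iff] at hf
      split_ifs at hf <;> simp only [Prod.mk.injEq] at hf <;> omega
    | v x' y' =>
      rw [h.apply_h rfl, h.apply_v hf]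
      exact hd
  | v x y =>
    cases f with
    | h x' y' =>
      rw [h.apply_h hf, h.apply_v rfl]
      exact hd.symm
    | v x' y' =>
      rw [v_mem_incidentEdges] at he hfp
      rw [ne_eq, Edge.v.injEq, Fin.ext_iff, Fin.ext_iff] at hne
      simp only [face, Nat.even_iff] at hf
      split_ifs at hf <;> simp only [Prod.mk.injEq] at hf <;> omega

theorem exists_face_partner {n : ℕ} (s : ℕ) {e : Edge n} {p : Fin n × Fin n}
    (he : e ∈ incidentEdges p) : ∃ f ∈ incidentEdges p, f ≠ e ∧ face s f = face s e := by
  obtain ⟨⟨a, ha⟩, ⟨b, hb⟩⟩ := p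
  cases e with
  | h x y =>
    rw [h_mem_incidentEdges] at he
    simp only at he
    by_cases hp : Even (x.val + y.val + s)
    · refine ⟨Edge.v ⟨a, ha⟩ ⟨b + 1, by omega⟩, v_mem_incidentEdges.2 ⟨rfl, Or.inr rfl⟩, by simp, ?_⟩
      rw [Nat.even_iff] at hp
      simp only [face, Nat.even_iff]
      split_ifs <;> simp only [Prod.mk.injEq] <;> omega
    · refine ⟨Edge.v ⟨a, ha⟩ ⟨b, by omega⟩, v_mem_incidentEdges.2 ⟨rfl, Or.inl rfl⟩, by simp, ?_⟩
      rw [Nat.even_iff] at hp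
      simp only [face, Nat.even_iff]
      split_ifs <;> simp only [Prod.mk.injEq] <;> omega
  | v x y =>
    rw [v_mem_incidentEdges] at he
    simp only at he
    by_cases hp : Even (x.val + y.val + s)
    · refine ⟨Edge.h ⟨a + 1, by omega⟩ ⟨b, hb⟩, h_mem_incidentEdges.2 ⟨Or.inr rfl, rfl⟩, by simp, ?_⟩
      rw [Nat.even_iff] at hp
      simp only [face, Nat.even_iff]
      split_ifs <;> simp only [Prod.mk.injEq] <;> omega
    · refine ⟨Edge.h ⟨a, by omega⟩ ⟨b, hb⟩, h_mem_incidentEdges.2 ⟨Or.inl rfl, rfl⟩, by simp, ?_⟩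
      rw [Nat.even_iff] at hp
      simp only [face, Nat.even_iff]
      split_ifs <;> simp only [Prod.mk.injEq] <;> omega

/-- The black edges of a face that does not alternate belong to one path. -/
theorem reachable_of_face_eq {n : ℕ} {φ : Edge n → Bool} {r s : ℕ} (hb : BoundaryAt r φ)
    {e f : Edge n} (hef : face s f = face s e)
    (hA : ¬ Alternating φ (face s e).1 (face s e).2) (he : φ e = true) (hf : φ f = true) :
    (blackGraph φ).Reachable e f := by
  rw [boundaryAt_iff] at hb
  obtain ⟨b1, b2, b3, b4⟩ := hb
  have hh : ∀ (x : Fin (n + 1)) (y y' : Fin n), y'.val = y.val + 1 →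
      ¬ Alternating φ x y' → hColor φ x y = true → hColor φ x y' = true →
      (blackGraph φ).Reachable (Edge.h x y) (Edge.h x y') := by
    intro x y y' hy hA h1 h2
    have hx := x.2
    by_cases x0 : x.val = 0
    · rw [x0, b4 _ y.2] at h1
      rw [x0, b4 _ y'.2] at h2
      rw [Nat.even_iff] at h1 h2
      omega
    by_cases xn : x.val = n
    · rw [xn, b2 _ y.2] at h1
      rw [xn, b2 _ y'.2] at h2
      rw [Nat.even_iff] at h1 h2
      omega
    have hv : vColor φ (x - 1) y' = true ∨ vColor φ x y' = true := by
      by_contra! hc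
      refine hA ⟨by omega, by omega, by omega, y'.2, ?_, ?_, ?_⟩
      · rw [show y'.val - 1 = y.val by omega, h1, h2]
      · rw [Bool.eq_false_iff.2 hc.1, Bool.eq_false_iff.2 hc.2]
      · rw [h2]
        exact hc.2.symm
    obtain ⟨z, hz, hzx⟩ : ∃ z : Fin n, vColor φ z y' = true ∧ (z.val = x - 1 ∨ z.val = x) := by
      rcases hv with hv | hv
      · exact ⟨⟨x - 1, by omega⟩, hv, Or.inl rfl⟩
      · exact ⟨⟨x, by omega⟩, hv, Or.inr rfl⟩
    have r1 : (blackGraph φ).Reachable (Edge.h x y) (Edge.v z y'.castSucc) :=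
      reachable_of_mem (p := (z, y))
        (h_mem_incidentEdges.2 ⟨by simp only; omega, rfl⟩)
        (v_mem_incidentEdges.2 ⟨rfl, by simp only [Fin.val_castSucc]; omega⟩)
        (by rw [apply_h φ, h1]) (by rw [apply_v φ, Fin.val_castSucc, hz])
    have r2 : (blackGraph φ).Reachable (Edge.v z y'.castSucc) (Edge.h x y') :=
      reachable_of_mem (p := (z, y'))
        (v_mem_incidentEdges.2 ⟨rfl, Or.inl rfl⟩)
        (h_mem_incidentEdges.2 ⟨by simp only; omega, rfl⟩)
        (by rw [apply_v φ, Fin.val_castSucc, hz]) (by rw [apply_h φ, h2])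
    exact r1.trans r2
  have hv : ∀ (x x' : Fin n) (y : Fin (n + 1)), x'.val = x.val + 1 →
      ¬ Alternating φ x' y → vColor φ x y = true → vColor φ x' y = true →
      (blackGraph φ).Reachable (Edge.v x y) (Edge.v x' y) := by
    intro x x' y hx hA h1 h2
    have hy := y.2
    by_cases y0 : y.val = 0
    · rw [y0, b1 _ x.2] at h1
      rw [y0, b1 _ x'.2] at h2
      rw [Nat.even_iff] at h1 h2
      omega
    by_cases yn : y.val = n
    · rw [yn, b3 _ x.2] at h1
      rw [yn, b3 _ x'.2] at h2
      rw [Nat.even_iff] at h1 h2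
      omega
    have hv : hColor φ x' (y - 1) = true ∨ hColor φ x' y = true := by
      by_contra! hc
      refine hA ⟨by omega, x'.2, by omega, by omega, ?_, ?_, ?_⟩
      · rw [Bool.eq_false_iff.2 hc.1, Bool.eq_false_iff.2 hc.2]
      · rw [show x'.val - 1 = x.val by omega, h1, h2]
      · rw [h2]
        exact hc.2
    obtain ⟨z, hz, hzx⟩ : ∃ z : Fin n, hColor φ x' z = true ∧ (z.val = y - 1 ∨ z.val = y) := by
      rcases hv with hv | hv
      · exact ⟨⟨y - 1, by omega⟩, hv, Or.inl rfl⟩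
      · exact ⟨⟨y, by omega⟩, hv, Or.inr rfl⟩
    have r1 : (blackGraph φ).Reachable (Edge.v x y) (Edge.h x'.castSucc z) :=
      reachable_of_mem (p := (x, z))
        (v_mem_incidentEdges.2 ⟨rfl, by simp only; omega⟩)
        (h_mem_incidentEdges.2 ⟨by simp only [Fin.val_castSucc]; omega, rfl⟩)
        (by rw [apply_v φ, h1]) (by rw [apply_h φ, Fin.val_castSucc, hz])
    have r2 : (blackGraph φ).Reachable (Edge.h x'.castSucc z) (Edge.v x' y) :=
      reachable_of_mem (p := (x', z))
        (h_mem_incidentEdges.2 ⟨Or.inl rfl, rfl⟩)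
        (v_mem_incidentEdges.2 ⟨rfl, by simp only; omega⟩)
        (by rw [apply_h φ, Fin.val_castSucc, hz]) (by rw [apply_v φ, h2])
    exact r1.trans r2
  -- A horizontal and a vertical edge of the same face share a vertex.
  have hhv : ∀ (x : Fin (n + 1)) (y : Fin n) (x' : Fin n) (y' : Fin (n + 1)),
      face s (Edge.v x' y') = face s (Edge.h x y) → φ (Edge.h x y) = true →
      φ (Edge.v x' y') = true → (blackGraph φ).Reachable (Edge.h x y) (Edge.v x' y') := by
    intro x y x' y' hf h1 h2
    simp only [face] at hf
    refine reachable_of_mem (p := (x', y)) (h_mem_incidentEdges.2 ⟨?_, rfl⟩)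
      (v_mem_incidentEdges.2 ⟨rfl, ?_⟩) h1 h2 <;>
    · simp only
      split_ifs at hf <;> simp only [Prod.mk.injEq] at hf <;> omega
  cases e with
  | h x y =>
    cases f with
    | h x' y' =>
      rw [apply_h φ] at he hf
      have hface := hef
      simp only [face] at hef hA
      have hx : x' = x := by
        rw [Fin.ext_iff]
        split_ifs at hef <;> simp only [Prod.mk.injEq] at hef <;> omega
      subst hx
      have hy : y'.val = y.val ∨ (y'.val = y.val + 1 ∧ Even (x'.val + y.val + s)) ∨
          (y.val = y'.val + 1 ∧ ¬ Even (x'.val + y.val + s)) := by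
        split_ifs at hef with c1 c2 c2 <;> simp only [Prod.mk.injEq] at hef <;> grind
      rcases hy with hy | ⟨hy, hp⟩ | ⟨hy, hp⟩
      · rw [Fin.ext hy]
      · rw [if_pos hp] at hA
        exact hh _ _ _ hy (by rw [hy]; exact hA) he hf
      · rw [if_neg hp] at hA
        exact (hh _ _ _ hy hA hf he).symm
    | v x' y' => exact hhv _ _ _ _ hef he hf
  | v x y =>
    cases f with
    | h x' y' => exact (hhv _ _ _ _ hef.symm hf he).symm
    | v x' y' =>
      rw [apply_v φ] at he hf
      simp only [face] at hef hA
      have hy : y' = y := by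
        rw [Fin.ext_iff]
        split_ifs at hef <;> simp only [Prod.mk.injEq] at hef <;> omega
      subst hy
      have hx : x'.val = x.val ∨ (x'.val = x.val + 1 ∧ Even (x.val + y'.val + s)) ∨
          (x.val = x'.val + 1 ∧ ¬ Even (x.val + y'.val + s)) := by
        split_ifs at hef with c1 c2 c2 <;> simp only [Prod.mk.injEq] at hef <;> grind
      rcases hx with hx | ⟨hx, hp⟩ | ⟨hx, hp⟩
      · rw [Fin.ext hx]
      · rw [if_pos hp] at hA
        exact hv _ _ _ hx (by rw [hx]; exact hA) he hf
      · rw [if_neg hp] at hA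
        exact (hv _ _ _ hx hA hf he).symm

/-- A black path of `φ` and its image under the half-gyration pass through the same faces, by the
same vertices; only the edges used inside a face that does not alternate are exchanged. -/
theorem exists_reachable_gyration {n : ℕ} {s : ℕ} {φ : Edge n → Bool} (hi : IceRule φ)
    (hb : BoundaryAt s φ) {e e' f : Edge n} (hee : face s e' = face s e)
    (hA : ¬ Alternating φ (face s e).1 (face s e).2)
    (he' : gyration s φ e' = true) (h : (blackGraph φ).Reachable e f) :
    ∃ f', face s f' = face s f ∧ (Alternating φ (face s f).1 (face s f).2 → f' = f) ∧
      gyration s φ f' = true ∧ (blackGraph (gyration s φ)).Reachable e' f' := by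
  rw [SimpleGraph.reachable_iff_reflTransGen] at h
  induction h with
  | refl => exact ⟨e', hee, fun h => absurd h hA, he', SimpleGraph.Reachable.refl _⟩
  | @tail f g _ hadj ih =>
    obtain ⟨f', h1, h2, h3, h4⟩ := ih
    obtain ⟨hne, bf, bg, p, hf, hg⟩ := hadj
    by_cases hfg : face s g = face s f
    · refine ⟨f', by rw [hfg, h1], fun hAg => ?_, h3, h4⟩
      rw [hfg] at hAg
      exact absurd (bf.trans bg.symm) (hAg.apply_ne hfg hf hg hne)
    · -- The path passes from one face to another: each of them keeps one black edge at `p`.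
      have key : ∀ a c : Edge n, φ a = true → φ c = true → a ∈ incidentEdges p →
          c ∈ incidentEdges p → a ≠ c → face s c ≠ face s a →
          ∃ a' ∈ incidentEdges p, face s a' = face s a ∧
            (Alternating φ (face s a).1 (face s a).2 → a' = a) ∧ gyration s φ a' = true := by
        intro a c ba bc ha hc hac hca
        by_cases hAa : Alternating φ (face s a).1 (face s a).2
        · exact ⟨a, ha, rfl, fun _ => rfl, by rw [gyration, if_pos hAa, ba]⟩
        · obtain ⟨d, hd, hda, hfd⟩ := exists_face_partner s ha
          have bd : φ d = false := by
            by_contra! hbd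
            rw [ne_eq, Bool.not_eq_false] at hbd
            rcases hi.eq_or_eq ha hc hd ba bc hbd hac with rfl | rfl
            · exact hda rfl
            · exact hca hfd
          exact ⟨d, hd, hfd, fun h => absurd h hAa, by
            rw [gyration, hfd, if_neg hAa, bd]; rfl⟩
      obtain ⟨f₂, m1, m2, m3, m4⟩ := key f g bf bg hf hg hne hfg
      obtain ⟨g₂, k1, k2, k3, k4⟩ := key g f bg bf hg hf hne.symm (Ne.symm hfg)
      have r1 : (blackGraph (gyration s φ)).Reachable f' f₂ := by
        by_cases hAf : Alternating φ (face s f).1 (face s f).2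
        · rw [h2 hAf, m3 hAf]
        · refine reachable_of_face_eq (s := s) (boundaryAt_gyration s hb) (by rw [m2, h1]) ?_ h3 m4
          rwa [h1, alternating_gyration (not_even_face s f)]
      exact ⟨g₂, k2, k3, k4, h4.trans (r1.trans (reachable_of_mem m1 k1 m4 k4))⟩

/-- The labels move along with the half-gyration, which therefore preserves the link pattern. -/
theorem patternAt_gyration {n : ℕ} {s : ℕ} {φ : Edge n → Bool} {π : LinkPattern n}
    (hi : IceRule φ) (hb : BoundaryAt s φ) (h : PatternAt s φ π) :
    PatternAt (s + 1) (gyration s φ) π := by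
  have hi' := iceRule_gyration s hi
  have hb' := boundaryAt_gyration s hb
  obtain ⟨ρ, hρ⟩ := exists_patternAt hi' hb'
  have : ρ = π := by
    refine hρ.eq_of_reachable fun i => ?_
    have hn : 0 < n := by have := i.isLt; omega
    have hface : ∀ j : Fin (2 * n), face s (leg (s + 1) j) = face s (leg s j) := fun j =>
      face_boundaryMod_succ hn (show Even (2 * j.val + s + s) by rw [Nat.even_iff]; omega)
    have hnA : ∀ j : Fin (2 * n),
        ¬ Alternating φ (face s (leg s j)).1 (face s (leg s j)).2 := fun j =>
      not_alternating_face_boundaryEdge φ s _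
    obtain ⟨f', h1, -, h3, h4⟩ := exists_reachable_gyration hi hb (hface i) (hnA i)
      (apply_leg hb' i) (h.reachable i)
    refine h4.trans (reachable_of_face_eq hb' (by rw [h1, hface]) ?_ h3 (apply_leg hb' _))
    rw [h1, alternating_gyration (not_even_face s _)]
    exact hnA _
  rwa [this] at hρ

/-- The half-gyration as a bijection between the configurations at successive times. -/
def gyrationEquiv (n s : ℕ) : Config n s ≃ Config n (s + 1) where
  toFun φ := ⟨gyration s φ.1, iceRule_gyration s φ.2.1, boundaryAt_gyration s φ.2.2⟩
  invFun φ := ⟨gyration s φ.1, iceRule_gyration s φ.2.1,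
    (boundaryAt_congr (by rw [Nat.even_iff]; omega)).1 (boundaryAt_gyration s φ.2.2)⟩
  left_inv φ := Subtype.ext (gyration_gyration s φ.1)
  right_inv φ := Subtype.ext (gyration_gyration s φ.1)

theorem linkPattern_gyrationEquiv {n s : ℕ} (φ : Config n s) :
    linkPattern (gyrationEquiv n s φ) = linkPattern φ :=
  (patternAt_linkPattern _).unique
    (patternAt_gyration φ.2.1 φ.2.2 (patternAt_linkPattern φ))

/-! ### Flipping a face above the bottom row -/

/-- The colouring with the four edges of the face `(x, 1)` inverted. -/
def flipFace {n : ℕ} (x : ℕ) (φ : Edge n → Bool) : Edge n → Bool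
  | Edge.h a b => if a.val = x ∧ b.val ≤ 1 then !φ (Edge.h a b) else φ (Edge.h a b)
  | Edge.v a b => if b.val = 1 ∧ (a.val = x ∨ a.val + 1 = x) then !φ (Edge.v a b)
      else φ (Edge.v a b)

theorem hColor_flipFace {n : ℕ} (x : ℕ) (φ : Edge n → Bool) {a b : ℕ} (ha : a ≤ n) (hb : b < n) :
    hColor (flipFace x φ) a b = if a = x ∧ b ≤ 1 then !hColor φ a b else hColor φ a b := by
  have h := apply_h (flipFace x φ) ⟨a, by omega⟩ ⟨b, hb⟩
  simp only at h
  rw [← h]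
  simp only [flipFace, apply_h]

theorem vColor_flipFace {n : ℕ} (x : ℕ) (φ : Edge n → Bool) {a b : ℕ} (ha : a < n) (hb : b ≤ n) :
    vColor (flipFace x φ) a b =
      if b = 1 ∧ (a = x ∨ a + 1 = x) then !vColor φ a b else vColor φ a b := by
  have h := apply_v (flipFace x φ) ⟨a, ha⟩ ⟨b, by omega⟩
  simp only at h
  rw [← h]
  simp only [flipFace, apply_v]

theorem flipFace_flipFace {n : ℕ} (x : ℕ) (φ : Edge n → Bool) :
    flipFace x (flipFace x φ) = φ := by
  funext e
  cases e <;> simp only [flipFace] <;> split_ifs <;> simp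

theorem alternating_flipFace {n : ℕ} {x : ℕ} {φ : Edge n → Bool} :
    Alternating (flipFace x φ) x 1 ↔ Alternating φ x 1 := by
  by_cases hf : 1 ≤ x ∧ x < n
  · obtain ⟨h1, h2⟩ := hf
    have e1 := hColor_flipFace x φ (a := x) (b := 0) (by omega) (by omega)
    have e2 := hColor_flipFace x φ (a := x) (b := 1) (by omega) (by omega)
    have e3 := vColor_flipFace x φ (a := x) (b := 1) (by omega) (by omega)
    have e4 := vColor_flipFace x φ (a := x - 1) (b := 1) (by omega) (by omega)
    rw [if_pos (by omega)] at e1 e2 e3 e4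
    simp only [Alternating, Nat.sub_self, e1, e2, e3, e4, ne_eq, Bool.not_inj_iff]
  · constructor <;> intro hA <;> exact absurd ⟨hA.1, hA.2.1⟩ hf

theorem iceRule_flipFace {n : ℕ} {x : ℕ} {φ : Edge n → Bool} (h : IceRule φ)
    (hA : Alternating φ x 1) : IceRule (flipFace x φ) := by
  obtain ⟨h1, h2, -, h3, h4, h5, h6⟩ := hA
  rw [iceRule_iff] at h ⊢
  intro a b ha hb
  have h0 := h a b ha hb
  rw [hColor_flipFace x φ ha.le hb, hColor_flipFace x φ ha hb, vColor_flipFace x φ ha hb.le,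
    vColor_flipFace x φ ha hb]
  by_cases hab : (a = x ∨ a + 1 = x) ∧ b ≤ 1
  · obtain ⟨rfl | rfl, hb1⟩ := hab
    · obtain rfl | rfl : b = 0 ∨ b = 1 := by omega
      · simp only [Nat.sub_self] at h4
        rw [← h4] at h6
        revert h0 h6
        simp
        cases hColor φ a 0 <;> cases hColor φ (a + 1) 0 <;> cases vColor φ a 0 <;>
          cases vColor φ a 1 <;> simp
      · revert h0 h6
        simp
        cases hColor φ a 1 <;> cases hColor φ (a + 1) 1 <;> cases vColor φ a 1 <;>
          cases vColor φ a 2 <;> simp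
    · rw [Nat.add_sub_cancel] at h5
      rw [← h5] at h6
      obtain rfl | rfl : b = 0 ∨ b = 1 := by omega
      · simp only [Nat.sub_self] at h4
        rw [← h4] at h6
        revert h0 h6
        simp
        cases hColor φ a 0 <;> cases hColor φ (a + 1) 0 <;> cases vColor φ a 0 <;>
          cases vColor φ a 1 <;> simp
      · revert h0 h6
        simp
        cases hColor φ a 1 <;> cases hColor φ (a + 1) 1 <;> cases vColor φ a 1 <;>
          cases vColor φ a 2 <;> simp
  · rw [if_neg (by omega), if_neg (by omega), if_neg (by omega), if_neg (by omega)]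
    exact h0

theorem boundaryAt_flipFace {n : ℕ} {s x : ℕ} {φ : Edge n → Bool} (h : BoundaryAt s φ)
    (h1 : 1 ≤ x) (h2 : x < n) : BoundaryAt s (flipFace x φ) := by
  rw [boundaryAt_iff] at h ⊢
  obtain ⟨b1, b2, b3, b4⟩ := h
  refine ⟨fun a ha => ?_, fun b hb => ?_, fun a ha => ?_, fun b hb => ?_⟩
  · rw [vColor_flipFace x φ ha (by omega), if_neg (by omega), b1 a ha]
  · rw [hColor_flipFace x φ le_rfl hb, if_neg (by omega), b2 b hb]
  · rw [vColor_flipFace x φ ha le_rfl, if_neg (by omega), b3 a ha]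
  · rw [hColor_flipFace x φ (by omega) hb, if_neg (by omega), b4 b hb]

/-- The label `2 n - 1`, which cyclically precedes the label `0`. -/
def lastLabel {n : ℕ} (hn : 0 < n) : Fin (2 * n) := ⟨2 * n - 1, by omega⟩

/-- The label `0`. -/
def firstLabel {n : ℕ} (hn : 0 < n) : Fin (2 * n) := ⟨0, by omega⟩

theorem cyclicSucc_lastLabel {n : ℕ} (hn : 0 < n) :
    cyclicSucc (lastLabel hn) = firstLabel hn := by
  have := cyclicSucc_val (lastLabel hn)
  have h1 : (lastLabel hn).val = 2 * n - 1 := rfl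
  refine Fin.ext ?_
  have h2 : (firstLabel hn).val = 0 := rfl
  omega

theorem lastLabel_ne_firstLabel {n : ℕ} (hn : 0 < n) : lastLabel hn ≠ firstLabel hn := by
  intro h
  have := Fin.ext_iff.1 h
  simp only [lastLabel, firstLabel] at this
  omega

theorem leg_firstLabel {n x : ℕ} (hx : x < n) :
    leg x (firstLabel (show 0 < n by omega)) = Edge.v ⟨x, hx⟩ 0 := by
  simp only [leg, firstLabel, boundaryEdge, mul_zero, zero_add]
  rw [dif_pos (by rw [Nat.mod_eq_of_lt (by omega)]; exact hx)]
  congr 2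
  exact Nat.mod_eq_of_lt (by omega)

theorem leg_lastLabel_one {n : ℕ} (hn : 0 < n) :
    leg 1 (lastLabel hn) = Edge.h 0 ⟨0, hn⟩ := by
  have h : (2 * (2 * n - 1) + 1) % (4 * n) = 4 * n - 1 := by
    rw [Nat.mod_eq_of_lt (by omega)]
    omega
  simp only [leg, lastLabel, boundaryEdge, h]
  rw [dif_neg (by omega), dif_neg (by omega), dif_neg (by omega)]
  congr 2
  omega

theorem leg_lastLabel_add_two {n x : ℕ} (hx : x + 2 < n) :
    leg (x + 2) (lastLabel (show 0 < n by omega)) = Edge.v ⟨x, by omega⟩ 0 := by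
  have h : (2 * (2 * n - 1) + (x + 2)) % (4 * n) = x := by
    rw [show 2 * (2 * n - 1) + (x + 2) = x + 4 * n by omega, Nat.add_mod_right]
    exact Nat.mod_eq_of_lt (by omega)
  simp only [leg, lastLabel, boundaryEdge, h]
  rw [dif_pos (by omega)]

theorem leg_lastLabel_zero_of_one_lt {n : ℕ} (hn : 1 < n) :
    leg 0 (lastLabel (show 0 < n by omega)) = Edge.h 0 ⟨1, hn⟩ := by
  have h : (2 * (2 * n - 1) + 0) % (4 * n) = 4 * n - 2 := by
    rw [Nat.mod_eq_of_lt (by omega)]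
    omega
  simp only [leg, lastLabel, boundaryEdge, h]
  rw [dif_neg (by omega), dif_neg (by omega), dif_neg (by omega)]
  congr 2
  omega

/-- At time `x + 1`, the horizontal edge on the left of the vertex `x` of the bottom row belongs to
the path of the last label if it is black. -/
theorem reachable_lastLabel {n x : ℕ} {φ : Edge n → Bool} (hb : BoundaryAt (x + 1) φ)
    (hx : x + 1 < n) (h : hColor φ x 0 = true) :
    (blackGraph φ).Reachable (Edge.h ⟨x, by omega⟩ ⟨0, by omega⟩)
      (leg (x + 1) (lastLabel (show 0 < n by omega))) := by
  have bl := apply_leg hb (lastLabel (show 0 < n by omega))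
  obtain _ | x := x
  · rw [leg_lastLabel_one]
    exact SimpleGraph.Reachable.refl _
  · rw [leg_lastLabel_add_two hx] at bl ⊢
    exact reachable_of_mem (p := (⟨x, by omega⟩, ⟨0, by omega⟩))
      (h_mem_incidentEdges.2 ⟨Or.inr rfl, rfl⟩) (v_mem_incidentEdges.2 ⟨rfl, Or.inl rfl⟩)
      (by rw [apply_h φ, h]) bl

theorem vColor_bottom {n s : ℕ} {φ : Edge n → Bool} (hb : BoundaryAt s φ) {x : ℕ} (hx : x < n) :
    vColor φ x 0 = decide (Even (x + s)) := by
  have := (boundaryAt_iff.1 hb).1 x hx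
  by_cases he : Even (x + s)
  · simp [he, this.2 he]
  · simp [he, mt this.1 he]

/-- At a bottom vertex with a white boundary edge, the two edges other than a white horizontal one
are black. -/
theorem colors_of_white_right {n x : ℕ} {φ : Edge n → Bool} (hi : IceRule φ)
    (hb : BoundaryAt (x + 1) φ) (hx : x < n) (h : hColor φ (x + 1) 0 = false) :
    hColor φ x 0 = true ∧ vColor φ x 1 = true := by
  have h0 := iceRule_iff.1 hi x 0 hx (by omega)
  have hv := vColor_bottom hb hx
  have hp : ¬ Even (x + (x + 1)) := by rw [Nat.even_iff]; omega
  simp only [hp, decide_false] at hv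
  rw [h, hv] at h0
  revert h0
  cases hColor φ x 0 <;> cases vColor φ x 1 <;> simp

theorem vColor_bottom_self {n x : ℕ} {φ : Edge n → Bool} (hb : BoundaryAt x φ) (hx : x < n) :
    vColor φ x 0 = true := by
  rw [vColor_bottom hb hx]
  simp

/-- Two white horizontal edges at the vertex `x` of the bottom row: if moreover the face `(x, 1)`
does not alternate, then the paths of the last and the first label join on top of that face, or on
the left side of the square if `x = 0`. -/
theorem reachable_of_not_alternating {n x : ℕ} {φ : Edge n → Bool} (hi : IceRule φ)
    (hb : BoundaryAt x φ) (hx : x < n) (h1 : hColor φ x 0 = false) (h2 : hColor φ (x + 1) 0 = false)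
    (hA : ¬ Alternating φ x 1) :
    (blackGraph φ).Reachable (leg x (firstLabel (show 0 < n by omega)))
      (leg x (lastLabel (show 0 < n by omega))) := by
  have b0 := vColor_bottom_self hb hx
  have h0 := iceRule_iff.1 hi x 0 hx (by omega)
  have v1 : vColor φ x 1 = true := by
    rw [h1, h2, b0] at h0
    revert h0
    cases vColor φ x 1 <;> simp
  have r1 : (blackGraph φ).Reachable (leg x (firstLabel (show 0 < n by omega)))
      (Edge.v ⟨x, hx⟩ ⟨1, by omega⟩) := by
    rw [leg_firstLabel hx]
    exact reachable_of_mem (p := (⟨x, hx⟩, ⟨0, by omega⟩))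
      (v_mem_incidentEdges.2 ⟨rfl, Or.inl rfl⟩) (v_mem_incidentEdges.2 ⟨rfl, Or.inr rfl⟩)
      (by rw [apply_v φ, Fin.val_zero, b0]) (by rw [apply_v φ, v1])
  refine r1.trans ?_
  have bl := apply_leg hb (lastLabel (show 0 < n by omega))
  obtain _ | x := x
  · by_cases hn : n = 1
    · subst hn
      have : leg 0 (lastLabel (show 0 < 1 by omega)) =
          (Edge.v ⟨0, hx⟩ ⟨1, by omega⟩ : Edge 1) := rfl
      rw [this]
    · rw [leg_lastLabel_zero_of_one_lt (by omega)] at bl ⊢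
      exact reachable_of_mem (p := (⟨0, hx⟩, ⟨1, by omega⟩))
        (v_mem_incidentEdges.2 ⟨rfl, Or.inl rfl⟩) (h_mem_incidentEdges.2 ⟨Or.inl rfl, rfl⟩)
        (by rw [apply_v φ, v1]) bl
  · obtain ⟨c1, c2⟩ := colors_of_white_right hi hb (by omega) h1
    have t1 : hColor φ (x + 1) 1 = true := by
      by_contra! hc
      rw [ne_eq, Bool.not_eq_true] at hc
      exact hA ⟨by omega, hx, le_rfl, by omega, by simp [h1, hc], by simp [c2, v1],
        by simp [hc, v1]⟩
    refine (reachable_of_mem (f := Edge.h ⟨x + 1, by omega⟩ ⟨1, by omega⟩)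
      (p := (⟨x + 1, hx⟩, ⟨1, by omega⟩))
      (v_mem_incidentEdges.2 ⟨rfl, Or.inl rfl⟩) (h_mem_incidentEdges.2 ⟨Or.inl rfl, rfl⟩)
      (by rw [apply_v φ, v1]) (by rw [apply_h φ, t1])).trans ?_
    refine (reachable_of_mem (f := Edge.v ⟨x, by omega⟩ ⟨1, by omega⟩)
      (p := (⟨x, by omega⟩, ⟨1, by omega⟩))
      (h_mem_incidentEdges.2 ⟨Or.inr rfl, rfl⟩) (v_mem_incidentEdges.2 ⟨rfl, Or.inl rfl⟩)
      (by rw [apply_h φ, t1]) (by rw [apply_v φ, c2])).trans ?_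
    refine (reachable_of_mem (f := Edge.h ⟨x, by omega⟩ ⟨0, by omega⟩)
      (p := (⟨x, by omega⟩, ⟨0, by omega⟩))
      (v_mem_incidentEdges.2 ⟨rfl, Or.inr rfl⟩) (h_mem_incidentEdges.2 ⟨Or.inl rfl, rfl⟩)
      (by rw [apply_v φ, c2]) (by rw [apply_h φ, c1])).trans ?_
    exact reachable_lastLabel hb hx c1

theorem tlMap_lastLabel_of_eq {n : ℕ} (hn : 0 < n) {π : LinkPattern n}
    (h : π.1 (lastLabel hn) = firstLabel hn) : tlMap (lastLabel hn) π = π := by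
  rw [tlMap, dif_pos (by rw [h, cyclicSucc_lastLabel])]

theorem tlMap_linkPattern_of_not_alternating {n x : ℕ} (φ : Config n x) (hx : x < n)
    (h1 : hColor φ.1 x 0 = false) (h2 : hColor φ.1 (x + 1) 0 = false)
    (hA : ¬ Alternating φ.1 x 1) :
    tlMap (lastLabel (show 0 < n by omega)) (linkPattern φ) = linkPattern φ := by
  refine tlMap_lastLabel_of_eq _ ?_
  exact (patternAt_linkPattern φ _ _ (lastLabel_ne_firstLabel _)).2
    (reachable_of_not_alternating φ.2.1 φ.2.2 hx h1 h2 hA).symm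

section Surgery

variable {n x : ℕ} {φ : Edge n → Bool}

/-- After the flip, the first and the last label are connected through the bottom edge of the
face. -/
theorem reachable_flipFace_first_last (hi : IceRule φ) (hb : BoundaryAt (x + 1) φ)
    (hx : x + 1 < n) (h : hColor φ (x + 1) 0 = false) :
    (blackGraph (flipFace (x + 1) φ)).Reachable (leg (x + 1) (firstLabel (show 0 < n by omega)))
      (leg (x + 1) (lastLabel (show 0 < n by omega))) := by
  obtain ⟨c1, c2⟩ := colors_of_white_right hi hb (by omega) h
  have hb' := boundaryAt_flipFace hb (by omega) hx
  have h0 : hColor (flipFace (x + 1) φ) (x + 1) 0 = true := by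
    rw [hColor_flipFace _ _ (by omega) (by omega), if_pos (by omega), h]
    rfl
  have c1' : hColor (flipFace (x + 1) φ) x 0 = true := by
    rw [hColor_flipFace _ _ (by omega) (by omega), if_neg (by omega), c1]
  have bl := apply_leg hb' (firstLabel (show 0 < n by omega))
  rw [leg_firstLabel hx] at bl ⊢
  refine (reachable_of_mem (f := Edge.h ⟨x + 1, by omega⟩ ⟨0, by omega⟩)
    (p := (⟨x + 1, hx⟩, ⟨0, by omega⟩))
    (v_mem_incidentEdges.2 ⟨rfl, Or.inl rfl⟩) (h_mem_incidentEdges.2 ⟨Or.inl rfl, rfl⟩)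
    bl (by rw [apply_h (flipFace (x + 1) φ), h0])).trans ?_
  refine (reachable_of_mem (f := Edge.h ⟨x, by omega⟩ ⟨0, by omega⟩)
    (p := (⟨x, by omega⟩, ⟨0, by omega⟩))
    (h_mem_incidentEdges.2 ⟨Or.inr rfl, rfl⟩) (h_mem_incidentEdges.2 ⟨Or.inl rfl, rfl⟩)
    (by rw [apply_h (flipFace (x + 1) φ), h0]) (by rw [apply_h (flipFace (x + 1) φ), c1'])).trans ?_
  exact reachable_lastLabel hb' hx c1'

/-- Outside the flipped face, a path that does not start at the first or last label can be followed
until it meets the top edge of the face. -/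
theorem reachable_flipFace_or (hi : IceRule φ) (hb : BoundaryAt (x + 1) φ)
    (hx : x + 1 < n) (hA : Alternating φ (x + 1) 1) (h : hColor φ (x + 1) 0 = false)
    {i : Fin (2 * n)} (i1 : i ≠ firstLabel (show 0 < n by omega))
    (i2 : i ≠ lastLabel (show 0 < n by omega)) {f : Edge n}
    (hf : (blackGraph φ).Reachable (leg (x + 1) i) f) :
    (blackGraph (flipFace (x + 1) φ)).Reachable (leg (x + 1) i) f ∨
    (blackGraph (flipFace (x + 1) φ)).Reachable (leg (x + 1) i)
      (Edge.h ⟨x + 1, by omega⟩ ⟨1, by omega⟩) := by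
  have hn : 0 < n := by omega
  have hi' := iceRule_flipFace hi hA
  have hb' := boundaryAt_flipFace hb (by omega) hx
  obtain ⟨c1, c2⟩ := colors_of_white_right hi hb (by omega) h
  have hfl := reachable_flipFace_first_last hi hb hx h
  have b0 := vColor_bottom_self hb hx
  have not_first : ¬ (blackGraph (flipFace (x + 1) φ)).Reachable (leg (x + 1) i)
      (leg (x + 1) (firstLabel hn)) := fun hr =>
    i2 (leg_reachable_unique hi' i1 (lastLabel_ne_firstLabel hn) hr.symm hfl)
  have top : hColor (flipFace (x + 1) φ) (x + 1) 1 = true := by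
    have h4 := hA.2.2.2.2.1
    rw [Nat.sub_self, h] at h4
    rw [hColor_flipFace _ _ (by omega) (by omega), if_pos (by omega), ← h4]
    rfl
  rw [SimpleGraph.reachable_iff_reflTransGen] at hf
  induction hf with
  | refl => exact Or.inl (SimpleGraph.Reachable.refl _)
  | @tail f g _ hadj ih =>
    obtain ⟨hne, bf, bg, p, hfp, hgp⟩ := hadj
    rcases ih with ih | ih
    swap
    · exact Or.inr ih
    have bf' := reachable_black ih (apply_leg hb' i)
    by_cases bg' : flipFace (x + 1) φ g = true
    · exact Or.inl (ih.trans (reachable_of_mem hfp hgp bf' bg'))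
    right
    cases g with
    | h a b =>
      exfalso
      have hab : a.val = x + 1 ∧ b.val ≤ 1 := by
        by_contra hc
        simp only [flipFace] at bg'
        rw [if_neg hc] at bg'
        exact bg' bg
      -- The horizontal edges of the face are white before the flip.
      rw [apply_h φ, hab.1] at bg
      obtain h01 | h01 : b.val = 0 ∨ b.val = 1 := by omega
      · rw [h01, h] at bg
        cases bg
      · have h4 := hA.2.2.2.2.1
        rw [Nat.sub_self, h] at h4
        rw [h01, ← h4] at bg
        cases bg
    | v a b =>
      have hab : b.val = 1 ∧ (a.val = x + 1 ∨ a.val + 1 = x + 1) := by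
        by_contra hc
        simp only [flipFace] at bg'
        rw [if_neg hc] at bg'
        exact bg' bg
      have hgp' := v_mem_incidentEdges.1 hgp
      obtain ⟨⟨q, hq⟩, ⟨r, hr⟩⟩ := p
      simp only at hgp'
      obtain rfl | rfl : r = 1 ∨ r = 0 := by omega
      · refine ih.trans (reachable_of_mem hfp (h_mem_incidentEdges.2 ⟨?_, rfl⟩) bf'
          (by rw [apply_h (flipFace (x + 1) φ), top]))
        simp only
        omega
      · exfalso
        obtain rfl | rfl : q = x + 1 ∨ q = x := by omega
        · have hm : Edge.v ⟨x + 1, hq⟩ 0 ∈ incidentEdges (⟨x + 1, hq⟩, ⟨0, hr⟩) :=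
            v_mem_incidentEdges.2 ⟨rfl, Or.inl rfl⟩
          rcases hi.eq_or_eq hfp hgp hm bf bg (by rw [apply_v φ, Fin.val_zero, b0]) hne
            with heq | heq
          · refine not_first ?_
            rw [leg_firstLabel hx, heq]
            exact ih
          · have := (Fin.ext_iff.1 (Edge.v.inj heq).2).symm
            rw [hab.1, Fin.val_zero] at this
            cases this
        · have hm : Edge.h ⟨q, by omega⟩ ⟨0, hr⟩ ∈ incidentEdges (⟨q, hq⟩, ⟨0, hr⟩) :=
            h_mem_incidentEdges.2 ⟨Or.inl rfl, rfl⟩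
          rcases hi.eq_or_eq hfp hgp hm bf bg (by rw [apply_h φ, c1]) hne with heq | heq
          · have c1' : hColor (flipFace (q + 1) φ) q 0 = true := by
              rw [hColor_flipFace _ _ (by omega) (by omega), if_neg (by omega), c1]
            have hl := reachable_lastLabel hb' hx c1'
            rw [heq] at hl
            exact not_first ((ih.trans hl).trans hfl.symm)
          · cases heq

end Surgery

/-- Flipping a face between two vertical lines that come from neighbouring labels acts on the link
pattern as a Temperley–Lieb operator. -/
theorem patternAt_flipFace {n x : ℕ} {φ : Edge n → Bool} {π : LinkPattern n} (hi : IceRule φ)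
    (hb : BoundaryAt (x + 1) φ) (hx : x + 1 < n) (hA : Alternating φ (x + 1) 1)
    (h : hColor φ (x + 1) 0 = false) (hπ : PatternAt (x + 1) φ π) :
    PatternAt (x + 1) (flipFace (x + 1) φ) (tlMap (lastLabel (show 0 < n by omega)) π) := by
  have hn : 0 < n := by omega
  have hi' := iceRule_flipFace hi hA
  have hb' := boundaryAt_flipFace hb (by omega) hx
  have hfl := reachable_flipFace_first_last hi hb hx h
  obtain ⟨ρ, hρ⟩ := exists_patternAt hi' hb'
  have key := fun i i1 i2 => reachable_flipFace_or hi hb hx hA h (i := i) i1 i2 (hπ.reachable i)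
  have hinv := π.2.1
  -- Paths between other labels survive: if they are cut, both halves end at the top edge.
  have other : ∀ i, i ≠ firstLabel hn → i ≠ lastLabel hn → π.1 i ≠ firstLabel hn →
      π.1 i ≠ lastLabel hn → (blackGraph (flipFace (x + 1) φ)).Reachable (leg (x + 1) i)
        (leg (x + 1) (π.1 i)) := by
    intro i i1 i2 j1 j2
    rcases key i i1 i2 with h1 | h1
    · exact h1
    · rcases key (π.1 i) j1 j2 with h2 | h2
      · rw [hinv] at h2
        exact h2.symm
      · exact h1.trans h2.symm
  have cut : ∀ i, i ≠ firstLabel hn → i ≠ lastLabel hn →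
      (π.1 i = firstLabel hn ∨ π.1 i = lastLabel hn) →
      (blackGraph (flipFace (x + 1) φ)).Reachable (leg (x + 1) i)
        (Edge.h ⟨x + 1, by omega⟩ ⟨1, by omega⟩) := by
    intro i i1 i2 hj
    rcases key i i1 i2 with h1 | h1
    · exfalso
      rcases hj with hj | hj <;> rw [hj] at h1
      · exact i2 (leg_reachable_unique hi' i1 (lastLabel_ne_firstLabel hn) h1.symm hfl)
      · exact i1 (leg_reachable_unique hi' i2 (lastLabel_ne_firstLabel hn).symm h1.symm hfl.symm)
    · exact h1
  have : ρ = tlMap (lastLabel hn) π := by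
    refine hρ.eq_of_reachable fun i => ?_
    by_cases hl : π.1 (lastLabel hn) = firstLabel hn
    · rw [tlMap_lastLabel_of_eq hn hl]
      have hl' : π.1 (firstLabel hn) = lastLabel hn := by rw [← hl, hinv]
      by_cases i1 : i = firstLabel hn
      · rw [i1, hl']
        exact hfl
      by_cases i2 : i = lastLabel hn
      · rw [i2, hl]
        exact hfl.symm
      refine other i i1 i2 (fun hc => i2 ?_) (fun hc => i1 ?_)
      · rw [← hinv i, hc, hl']
      · rw [← hinv i, hc, hl]
    · rw [tlMap, dif_neg (by rw [cyclicSucc_lastLabel]; exact hl)]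
      have hfne := π.2.2.1 (firstLabel hn)
      have hlne := π.2.2.1 (lastLabel hn)
      have hf : π.1 (firstLabel hn) ≠ lastLabel hn := fun hc => hl (by rw [← hc, hinv])
      have cf := cut (π.1 (firstLabel hn)) hfne hf (Or.inl (hinv _))
      have cl := cut (π.1 (lastLabel hn)) hl hlne (Or.inr (hinv _))
      simp only [reconnect, cyclicSucc_lastLabel]
      split_ifs with i1 i2 i3 i4
      · rw [i1]
        exact hfl.symm
      · rw [i2]
        exact hfl
      · rw [i3]
        exact cl.trans cf.symm
      · rw [i4]
        exact cf.trans cl.symm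
      · exact other i i2 i1 (fun hc => i4 (by rw [← hc, hinv])) (fun hc => i3 (by rw [← hc, hinv]))
  rwa [this] at hρ

/-! ### Rotation of link patterns -/

/-- The cyclic predecessor `i - 1` of `i`, modulo `2 n`. -/
def cyclicPred {n : ℕ} (i : Fin (2 * n)) : Fin (2 * n) :=
  ⟨(i.val + (2 * n - 1)) % (2 * n), Nat.mod_lt _ (Nat.zero_lt_of_lt i.isLt)⟩

theorem cyclicPred_val {n : ℕ} (i : Fin (2 * n)) :
    (cyclicPred i).val + 1 = i.val ∨ i.val = 0 ∧ (cyclicPred i).val + 1 = 2 * n := by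
  have hlt := i.isLt
  by_cases h : i.val = 0
  · right
    refine ⟨h, ?_⟩
    simp only [cyclicPred, h, zero_add]
    rw [Nat.mod_eq_of_lt (by omega)]
    omega
  · left
    simp only [cyclicPred]
    rw [show i.val + (2 * n - 1) = i.val - 1 + 2 * n by omega, Nat.add_mod_right,
      Nat.mod_eq_of_lt (by omega)]
    omega

theorem cyclicSucc_cyclicPred {n : ℕ} (i : Fin (2 * n)) : cyclicSucc (cyclicPred i) = i := by
  have h1 := cyclicPred_val i
  have h2 := cyclicSucc_val (cyclicPred i)
  have := i.isLt
  exact Fin.ext (by omega)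

theorem cyclicPred_cyclicSucc {n : ℕ} (i : Fin (2 * n)) : cyclicPred (cyclicSucc i) = i := by
  have h1 := cyclicPred_val (cyclicSucc i)
  have h2 := cyclicSucc_val i
  have := i.isLt
  exact Fin.ext (by omega)

theorem cyclicSucc_injective {n : ℕ} : Function.Injective (cyclicSucc (n := n)) :=
  Function.LeftInverse.injective cyclicPred_cyclicSucc

theorem isLinkPattern_rotate {n : ℕ} {f : Fin (2 * n) → Fin (2 * n)} (hf : IsLinkPattern f) :
    IsLinkPattern fun i => cyclicSucc (f (cyclicPred i)) := by
  obtain ⟨h1, h2, h3⟩ := hf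
  refine ⟨fun i => ?_, fun i h => ?_, fun i j => ?_⟩
  · simp only
    rw [cyclicPred_cyclicSucc, h1, cyclicSucc_cyclicPred]
  · simp only at h
    apply h2 (cyclicPred i)
    rw [← cyclicPred_cyclicSucc (f (cyclicPred i)), h]
  · have a1 := cyclicPred_val i
    have a2 := cyclicPred_val j
    simp only
    generalize cyclicPred i = a at *
    generalize cyclicPred j = b at *
    have b1 := cyclicSucc_val (f a)
    have b2 := cyclicSucc_val (f b)
    have c1 := h3 a b
    have c2 := h3 b (f a)
    rw [h1] at c2
    simp only [Fin.lt_def] at *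
    have := a.isLt
    have := b.isLt
    have := (f a).isLt
    have := (f b).isLt
    omega

/-- The link pattern rotated by one step. -/
def rotate {n : ℕ} (π : LinkPattern n) : LinkPattern n :=
  ⟨fun i => cyclicSucc (π.1 (cyclicPred i)), isLinkPattern_rotate π.2⟩

theorem rotate_apply_cyclicSucc {n : ℕ} (π : LinkPattern n) (i : Fin (2 * n)) :
    (rotate π).1 (cyclicSucc i) = cyclicSucc (π.1 i) := by
  simp only [rotate, cyclicPred_cyclicSucc]

theorem eq_rotate {n : ℕ} {π ρ : LinkPattern n}
    (h : ∀ i, ρ.1 (cyclicSucc i) = cyclicSucc (π.1 i)) : ρ = rotate π := by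
  refine Subtype.ext (funext fun i => ?_)
  rw [← cyclicSucc_cyclicPred i, h, rotate_apply_cyclicSucc]

theorem tlMap_rotate {n : ℕ} (j : Fin (2 * n)) (π : LinkPattern n) :
    tlMap (cyclicSucc j) (rotate π) = rotate (tlMap j π) := by
  refine eq_rotate fun i => ?_
  have hinj : ∀ a b : Fin (2 * n), cyclicSucc a = cyclicSucc b ↔ a = b := fun a b =>
    cyclicSucc_injective.eq_iff
  unfold tlMap
  by_cases h : π.1 j = cyclicSucc j
  · rw [dif_pos (by rw [rotate_apply_cyclicSucc, h]), dif_pos h, rotate_apply_cyclicSucc]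
  · rw [dif_neg (by rw [rotate_apply_cyclicSucc, hinj]; exact h), dif_neg h]
    simp only [reconnect, rotate_apply_cyclicSucc, hinj]
    split_ifs <;> rfl

theorem leg_add_two {n s : ℕ} (i : Fin (2 * n)) : leg (s + 2) i = leg s (cyclicSucc i) := by
  have h := cyclicSucc_val i
  unfold leg
  congr 2
  rcases h with ⟨h, -⟩ | ⟨h, h'⟩ <;> rw [h]
  · congr 1
    ring
  · rw [show 2 * i.val + (s + 2) = 2 * 0 + s + 4 * n by omega, Nat.add_mod_right]

theorem patternAt_add_two {n s : ℕ} {φ : Edge n → Bool} {π : LinkPattern n}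
    (h : PatternAt (s + 2) φ π) : PatternAt s φ (rotate π) := by
  intro i j hij
  rw [← cyclicSucc_cyclicPred i, ← cyclicSucc_cyclicPred j] at hij ⊢
  rw [rotate_apply_cyclicSucc, cyclicSucc_injective.eq_iff, ← leg_add_two, ← leg_add_two]
  exact h _ _ fun hc => hij (by rw [hc])

/-- The configurations at times `s + 2` and `s` are the same; only the labels are shifted. -/
def configShift (n s : ℕ) : Config n (s + 2) ≃ Config n s :=
  Equiv.subtypeEquivRight fun _ =>
    and_congr_right fun _ => boundaryAt_congr (by rw [Nat.even_iff]; omega)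

theorem linkPattern_configShift {n s : ℕ} (φ : Config n (s + 2)) :
    linkPattern (configShift n s φ) = rotate (linkPattern φ) :=
  (patternAt_linkPattern _).unique (patternAt_add_two (patternAt_linkPattern φ))

/-- The full gyration. -/
def fullGyration (n s : ℕ) : Config n s ≃ Config n s :=
  (gyrationEquiv n s).trans ((gyrationEquiv n (s + 1)).trans (configShift n s))

theorem linkPattern_fullGyration {n s : ℕ} (φ : Config n s) :
    linkPattern (fullGyration n s φ) = rotate (linkPattern φ) := by
  rw [fullGyration, Equiv.trans_apply, Equiv.trans_apply, linkPattern_configShift,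
    linkPattern_gyrationEquiv, linkPattern_gyrationEquiv]

theorem sum_linkPattern_rotate {n s : ℕ} {M : Type*} [AddCommMonoid M] (F : LinkPattern n → M) :
    ∑ φ : Config n s, F (rotate (linkPattern φ)) = ∑ φ : Config n s, F (linkPattern φ) := by
  rw [← Equiv.sum_comp (fullGyration n s) fun φ => F (linkPattern φ)]
  simp only [linkPattern_fullGyration]

/-! ### Sums over the configurations with a given colour in the bottom row -/

/-- The full gyration at time `x` inverts the `x`-th horizontal edge of the bottom row exactly if
the face above it alternates. -/
theorem hColor_fullGyration {n x : ℕ} (hx : x < n) (φ : Config n x) :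
    hColor (fullGyration n x φ).1 x 0 =
      if Alternating φ.1 x 1 then !hColor φ.1 x 0 else hColor φ.1 x 0 := by
  have h : (fullGyration n x φ).1 = gyration (x + 1) (gyration x φ.1) := rfl
  have hp : ¬ Even (x + 0 + (x + 1)) := by rw [Nat.even_iff]; omega
  have hA : ¬ Alternating (gyration x φ.1) x 0 := fun h => by
    have := h.2.2.1
    omega
  rw [h, hColor_gyration _ _ hx.le (by omega), if_neg hp, if_neg hA,
    hColor_gyration _ _ hx.le (by omega), if_pos (by simp)]
  split_ifs <;> simp

open Classical in
/-- Along an orbit of the full gyration, the `x`-th horizontal edge of the bottom row changes from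
white to black as often as from black to white. -/
theorem sum_white_alternating {n x : ℕ} (hx : x < n) {M : Type*} [AddCommGroup M]
    {f : LinkPattern n → M} (hf : ∀ π, f (rotate π) = f π) :
    ∑ φ : Config n x, (if hColor φ.1 x 0 = false ∧ Alternating φ.1 x 1 then f (linkPattern φ)
      else 0) =
    ∑ φ : Config n x, (if hColor φ.1 x 0 = true ∧ Alternating φ.1 x 1 then f (linkPattern φ)
      else 0) := by
  have h := Equiv.sum_comp (fullGyration n x) fun φ =>
    if hColor φ.1 x 0 = false then f (linkPattern φ) else 0
  simp only [linkPattern_fullGyration, hf, hColor_fullGyration hx] at h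
  rw [← sub_eq_zero, ← Finset.sum_sub_distrib] at h ⊢
  rw [← neg_eq_zero, ← Finset.sum_neg_distrib]
  refine Eq.trans ?_ h
  refine Finset.sum_congr rfl fun φ _ => ?_
  by_cases hA : Alternating φ.1 x 1 <;> cases hColor φ.1 x 0 <;> simp [hA]

/-- The flip of the face `(x + 1, 1)` on the configurations where it alternates. -/
def flipConfig {n x : ℕ} (hx : x + 1 < n) (φ : Config n (x + 1))
    (hA : Alternating φ.1 (x + 1) 1) : Config n (x + 1) :=
  ⟨flipFace (x + 1) φ.1, iceRule_flipFace φ.2.1 hA,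
    boundaryAt_flipFace φ.2.2 (by omega) hx⟩

theorem linkPattern_flipConfig {n x : ℕ} (hx : x + 1 < n) (φ : Config n (x + 1))
    (hA : Alternating φ.1 (x + 1) 1) (h : hColor φ.1 (x + 1) 0 = false) :
    linkPattern (flipConfig hx φ hA) =
      tlMap (lastLabel (show 0 < n by omega)) (linkPattern φ) :=
  (patternAt_linkPattern _).unique
    (patternAt_flipFace φ.2.1 φ.2.2 hx hA h (patternAt_linkPattern φ))

open Classical in
theorem sum_white_alternating_tlMap {n x : ℕ} (hn : 0 < n) (hx : x < n) {M : Type*}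
    [AddCommGroup M] {f : LinkPattern n → M} (hf : ∀ π, f (rotate π) = f π) :
    ∑ φ : Config n x, (if hColor φ.1 x 0 = false ∧ Alternating φ.1 x 1 then
      f (tlMap (lastLabel hn) (linkPattern φ)) else 0) =
    ∑ φ : Config n x, (if hColor φ.1 x 0 = false ∧ Alternating φ.1 x 1 then
      f (linkPattern φ) else 0) := by
  rw [sum_white_alternating hx hf]
  obtain _ | x := x
  · refine Finset.sum_congr rfl fun φ _ => ?_
    have hA : ¬ Alternating φ.1 0 1 := fun h => by
      have := h.1
      omega
    simp [hA]
  · rw [← Finset.sum_filter, ← Finset.sum_filter]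
    have hflip : ∀ (φ : Config n (x + 1)) (hA : Alternating φ.1 (x + 1) 1),
        hColor (flipConfig hx φ hA).1 (x + 1) 0 = !hColor φ.1 (x + 1) 0 := by
      intro φ hA
      rw [flipConfig, hColor_flipFace _ _ (by omega) (by omega), if_pos (by omega)]
    refine Finset.sum_bij'
      (fun φ hφ => flipConfig hx φ (Finset.mem_filter.1 hφ).2.2)
      (fun φ hφ => flipConfig hx φ (Finset.mem_filter.1 hφ).2.2) ?_ ?_ ?_ ?_ ?_
    · intro φ hφ
      obtain ⟨-, h1, h2⟩ := Finset.mem_filter.1 hφ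
      exact Finset.mem_filter.2 ⟨Finset.mem_univ _, by rw [hflip, h1]; rfl,
        alternating_flipFace.2 h2⟩
    · intro φ hφ
      obtain ⟨-, h1, h2⟩ := Finset.mem_filter.1 hφ
      exact Finset.mem_filter.2 ⟨Finset.mem_univ _, by rw [hflip, h1]; rfl,
        alternating_flipFace.2 h2⟩
    · intro φ _
      exact Subtype.ext (flipFace_flipFace _ _)
    · intro φ _
      exact Subtype.ext (flipFace_flipFace _ _)
    · intro φ hφ
      obtain ⟨-, h1, h2⟩ := Finset.mem_filter.1 hφ
      rw [linkPattern_flipConfig hx φ h2 h1]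

/-- Downward induction on the column `x`: at time `x`, the configurations whose `x`-th horizontal
edge in the bottom row is white split according to the next edge. If that edge is black, the
half-gyration leads to the same kind of configurations at time `x + 1`; if it is white, the vertical
line at `x` is straight and the operator acts trivially or as a flip. -/
theorem sum_white_tlMap {n x : ℕ} (hn : 0 < n) (hx : x ≤ n) {M : Type*}
    [AddCommGroup M] {f : LinkPattern n → M} (hf : ∀ π, f (rotate π) = f π) :
    ∑ φ : Config n x, (if hColor φ.1 x 0 = false then
      f (tlMap (lastLabel hn) (linkPattern φ)) - f (linkPattern φ) else 0) = 0 := by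
  classical
  induction hx using Nat.decreasingInduction with
  | self =>
    refine Finset.sum_eq_zero fun φ _ => ?_
    have h := ((boundaryAt_iff.1 φ.2.2).2.1 0 hn).2 (by simp)
    rw [h]
    simp
  | of_succ x hx ih =>
    have h1 : ∑ φ : Config n x, (if hColor φ.1 (x + 1) 0 = true then
        f (tlMap (lastLabel hn) (linkPattern φ)) - f (linkPattern φ) else 0) = 0 := by
      rw [← Equiv.sum_comp (gyrationEquiv n x)] at ih
      refine Eq.trans ?_ ih
      refine Finset.sum_congr rfl fun φ _ => ?_
      rw [linkPattern_gyrationEquiv]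
      have hc : hColor (gyrationEquiv n x φ).1 (x + 1) 0 = !hColor φ.1 (x + 1) 0 := by
        have h : (gyrationEquiv n x φ).1 = gyration x φ.1 := rfl
        have hp : ¬ Even (x + 1 + 0 + x) := by rw [Nat.even_iff]; omega
        have hA : ¬ Alternating φ.1 (x + 1) 0 := fun h => by
          have := h.2.2.1
          omega
        rw [h, hColor_gyration _ _ hx hn, if_neg hp, if_neg hA]
      rw [hc]
      cases hColor φ.1 (x + 1) 0 <;> simp
    have h2 := sub_eq_zero.2 (sum_white_alternating_tlMap hn hx hf)
    rw [← Finset.sum_sub_distrib] at h2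
    have h3 := congrArg₂ (· + ·) h1 h2
    simp only [add_zero] at h3
    rw [← Finset.sum_add_distrib] at h3
    refine Eq.trans ?_ h3
    refine Finset.sum_congr rfl fun φ _ => ?_
    have h0 := iceRule_iff.1 φ.2.1 x 0 hx hn
    have hv := vColor_bottom_self φ.2.2 hx
    have triv := tlMap_linkPattern_of_not_alternating φ hx
    have hA : Alternating φ.1 x 1 → hColor φ.1 x 0 = false → vColor φ.1 x 1 = true := by
      rintro ⟨-, -, -, -, e1, -, e2⟩ e3
      rw [Nat.sub_self, e3] at e1
      rw [← e1] at e2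
      revert e2
      cases vColor φ.1 x 1 <;> simp
    revert h0 hv triv hA
    by_cases A : Alternating φ.1 x 1 <;> cases hColor φ.1 x 0 <;> cases hColor φ.1 (x + 1) 0 <;>
      cases vColor φ.1 x 0 <;> cases vColor φ.1 x 1 <;> simp +contextual [A]

/-! ### The eigenvalue equation -/

theorem iterate_cyclicSucc_val {n : ℕ} (m : ℕ) (j : Fin (2 * n)) :
    (cyclicSucc^[m] j).val = (j.val + m) % (2 * n) := by
  induction m with
  | zero => exact (Nat.mod_eq_of_lt j.isLt).symm
  | succ m ih =>
    rw [Function.iterate_succ_apply', cyclicSucc]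
    simp only
    rw [ih, Nat.mod_add_mod, add_assoc]

theorem iterate_cyclicSucc_two_mul {n : ℕ} (j : Fin (2 * n)) : cyclicSucc^[2 * n] j = j := by
  refine Fin.ext ?_
  rw [iterate_cyclicSucc_val, Nat.add_mod_right, Nat.mod_eq_of_lt j.isLt]

theorem iterate_rotate_apply {n : ℕ} (m : ℕ) (π : LinkPattern n) (i : Fin (2 * n)) :
    (rotate^[m] π).1 (cyclicSucc^[m] i) = cyclicSucc^[m] (π.1 i) := by
  induction m with
  | zero => rfl
  | succ m ih =>
    rw [Function.iterate_succ_apply', Function.iterate_succ_apply', Function.iterate_succ_apply',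
      rotate_apply_cyclicSucc, ih]

theorem iterate_rotate_two_mul {n : ℕ} (π : LinkPattern n) : rotate^[2 * n] π = π := by
  refine Subtype.ext (funext fun i => ?_)
  have h := iterate_rotate_apply (2 * n) π i
  rwa [iterate_cyclicSucc_two_mul, iterate_cyclicSucc_two_mul] at h

/-- A sum over all labels, taken by rotating a given one. -/
theorem sum_iterate_cyclicSucc {n : ℕ} {M : Type*} [AddCommMonoid M] (A : Fin (2 * n) → M)
    (j : Fin (2 * n)) : ∑ m ∈ Finset.range (2 * n), A (cyclicSucc^[m] j) = ∑ k, A k := by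
  rw [← Fin.sum_univ_eq_sum_range fun m => A (cyclicSucc^[m] j)]
  refine Function.Bijective.sum_comp (e := fun m : Fin (2 * n) => cyclicSucc^[m.val] j)
    (Finite.injective_iff_bijective.1 fun a b hab => ?_) A
  have h := Fin.ext_iff.1 hab
  simp only [iterate_cyclicSucc_val] at h
  have := eq_of_mod_eq h (by omega) (by omega)
  exact Fin.ext (by omega)

theorem sum_tlMap_iterate {n : ℕ} {M : Type*} [AddCommMonoid M] (F : LinkPattern n → M)
    (j : Fin (2 * n)) (m : ℕ) :
    ∑ φ : Config n 0, F (tlMap (cyclicSucc^[m] j) (linkPattern φ)) =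
      ∑ φ : Config n 0, F (rotate^[m] (tlMap j (linkPattern φ))) := by
  induction m generalizing F with
  | zero => rfl
  | succ m ih =>
    rw [Function.iterate_succ_apply',
      ← sum_linkPattern_rotate fun π => F (tlMap (cyclicSucc (cyclicSucc^[m] j)) π)]
    simp only [tlMap_rotate, Function.iterate_succ_apply']
    exact ih fun π => F (rotate π)

theorem sum_iterate_rotate {n : ℕ} {M : Type*} [AddCommMonoid M] (F : LinkPattern n → M)
    (m : ℕ) :
    ∑ φ : Config n 0, F (rotate^[m] (linkPattern φ)) = ∑ φ : Config n 0, F (linkPattern φ) := by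
  induction m generalizing F with
  | zero => rfl
  | succ m ih =>
    simp only [Function.iterate_succ_apply']
    rw [ih fun π => F (rotate π), sum_linkPattern_rotate]

theorem hColor_zero {n s : ℕ} {φ : Edge n → Bool} (hn : 0 < n) (hb : BoundaryAt s φ)
    (hs : Even s) : hColor φ 0 0 = false := by
  have h := (boundaryAt_iff.1 hb).2.2.2 0 hn
  rw [← Bool.not_eq_true, h, zero_add]
  exact not_not.2 hs

/-- The Razumov–Stroganov relation, tested against an arbitrary function of the link pattern. -/
theorem sum_sum_tlMap {n : ℕ} (hn : 0 < n) {M : Type*} [AddCommGroup M] (F : LinkPattern n → M) :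
    ∑ k : Fin (2 * n), ∑ φ : Config n 0, F (tlMap k (linkPattern φ)) =
      (2 * n) • ∑ φ : Config n 0, F (linkPattern φ) := by
  -- The average of `F` over the rotations is rotation invariant.
  set f : LinkPattern n → M := fun π => ∑ m ∈ Finset.range (2 * n), F (rotate^[m] π) with hf
  have hrot : ∀ π, f (rotate π) = f π := by
    intro π
    have h1 := Finset.sum_range_succ (fun m => F (rotate^[m] π)) (2 * n)
    rw [Finset.sum_range_succ', iterate_rotate_two_mul] at h1
    exact add_right_cancel h1
  have h := sum_white_tlMap hn (Nat.zero_le n) hrot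
  rw [Finset.sum_congr rfl fun φ _ => if_pos (hColor_zero hn φ.2.2 Even.zero),
    Finset.sum_sub_distrib, sub_eq_zero] at h
  rw [← sum_iterate_cyclicSucc _ (lastLabel hn)]
  simp only [sum_tlMap_iterate]
  rw [Finset.sum_comm]
  refine h.trans ?_
  rw [hf]
  simp only
  rw [Finset.sum_comm]
  simp only [sum_iterate_rotate, Finset.sum_const, Finset.card_range]

theorem hasLinkPattern_iff {n : ℕ} {φ : FPL n} {π : LinkPattern n} :
    HasLinkPattern φ π ↔ PatternAt 0 φ.1 π := by
  simp only [HasLinkPattern, PatternAt, leg_zero]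

/-- Fully-packed loop configurations are the configurations at time `0`. -/
def fplEquiv (n : ℕ) : FPL n ≃ Config n 0 :=
  Equiv.subtypeEquivRight fun _ => Iff.rfl

theorem hasLinkPattern_iff_eq {n : ℕ} {φ : FPL n} {π : LinkPattern n} :
    HasLinkPattern φ π ↔ linkPattern (fplEquiv n φ) = π := by
  rw [hasLinkPattern_iff]
  have h := patternAt_linkPattern (fplEquiv n φ)
  exact ⟨fun h' => h.unique h', fun h' => h' ▸ h⟩

theorem fplState_eq_sum (n : ℕ) :
    fplState n = ∑ φ : Config n 0, Finsupp.single (linkPattern φ) (1 : ℂ) := by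
  classical
  rw [fplState, ← Finset.sum_fiberwise Finset.univ linkPattern]
  refine Finset.sum_congr rfl fun π _ => ?_
  rw [Finset.sum_congr rfl fun φ hφ => by rw [(Finset.mem_filter.1 hφ).2], Finset.sum_const,
    Nat.cast_smul_eq_nsmul]
  congr 1
  rw [fplCount, Nat.card_congr ((fplEquiv n).subtypeEquiv
    (q := fun φ => linkPattern φ = π) fun φ => hasLinkPattern_iff_eq),
    Nat.card_eq_fintype_card, Fintype.card_subtype]

theorem hamiltonian_apply {n : ℕ} (v : LinkPattern n →₀ ℂ) :
    hamiltonian n v = ∑ k : Fin (2 * n), Finsupp.mapDomain (tlMap k) v := by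
  simp only [hamiltonian, LinearMap.sum_apply, Finsupp.lmapDomain_apply]

theorem hamiltonian_fplState {n : ℕ} (hn : 0 < n) :
    hamiltonian n (fplState n) = (2 * n : ℂ) • fplState n := by
  have h := sum_sum_tlMap hn fun π => Finsupp.single π (1 : ℂ)
  rw [hamiltonian_apply, fplState_eq_sum]
  simp only [Finsupp.mapDomain_finsetSum, Finsupp.mapDomain_single]
  rw [h, ← Nat.cast_smul_eq_nsmul ℂ]
  push_cast
  rfl

/-! ### Existence of a configuration -/

/-- The colouring that corresponds to the identity permutation matrix: the straight lines are on the
diagonal. -/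
def diagonalColouring (n : ℕ) : Edge n → Bool
  | Edge.h x y => xor (decide (Even (x.val + y.val))) (decide (x.val ≤ y.val))
  | Edge.v x y => xor (decide (Even (x.val + y.val))) (decide (x.val < y.val))

theorem hColor_diagonal {n x y : ℕ} (hx : x ≤ n) (hy : y < n) :
    hColor (diagonalColouring n) x y = xor (decide (Even (x + y))) (decide (x ≤ y)) :=
  (apply_h (diagonalColouring n) ⟨x, by omega⟩ ⟨y, hy⟩).symm

theorem vColor_diagonal {n x y : ℕ} (hx : x < n) (hy : y ≤ n) :
    vColor (diagonalColouring n) x y = xor (decide (Even (x + y))) (decide (x < y)) :=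
  (apply_v (diagonalColouring n) ⟨x, hx⟩ ⟨y, by omega⟩).symm

instance (n : ℕ) : Nonempty (Config n 0) := by
  refine ⟨⟨diagonalColouring n, iceRule_iff.2 fun x y hx hy => ?_, boundaryAt_iff.2
    ⟨fun x hx => ?_, fun y hy => ?_, fun x hx => ?_, fun y hy => ?_⟩⟩⟩
  · rw [hColor_diagonal hx.le hy, hColor_diagonal hx hy, vColor_diagonal hx hy.le,
      vColor_diagonal hx hy]
    have e1 : Even (x + 1 + y) ↔ ¬ Even (x + y) := by rw [Nat.even_iff, Nat.even_iff]; omega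
    have e2 : Even (x + (y + 1)) ↔ ¬ Even (x + y) := by rw [Nat.even_iff, Nat.even_iff]; omega
    simp only [e1, e2]
    rcases lt_trichotomy x y with h | h | h
    · have h1 : x ≤ y := by omega
      have h2 : x + 1 ≤ y := by omega
      have h3 : x < y + 1 := by omega
      by_cases he : Even (x + y) <;> simp [he, h, h1, h2, h3]
    · subst h
      simp
    · have h1 : ¬ x ≤ y := by omega
      have h2 : ¬ x + 1 ≤ y := by omega
      have h3 : ¬ x < y + 1 := by omega
      have h4 : ¬ x < y := by omega
      by_cases he : Even (x + y) <;> simp [he, h1, h2, h3, h4]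
  · rw [vColor_diagonal hx (by omega)]
    simp
  · rw [hColor_diagonal le_rfl hy, decide_eq_false (show ¬ n ≤ y by omega)]
    simp
  · rw [vColor_diagonal hx le_rfl, decide_eq_true hx]
    simp
  · rw [hColor_diagonal (by omega) hy, decide_eq_true (Nat.zero_le y)]
    simp

/-- The sum of the coefficients. -/
noncomputable def coeffSum {n : ℕ} (v : LinkPattern n →₀ ℂ) : ℂ := ∑ π, v π

theorem coeffSum_fplState_ne_zero (n : ℕ) : coeffSum (fplState n) ≠ 0 := by
  classical
  have : coeffSum (fplState n) = Fintype.card (Config n 0) := by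
    rw [fplState_eq_sum, coeffSum]
    simp only [Finsupp.finsetSum_apply]
    rw [Finset.sum_comm]
    simp [Finsupp.single_apply]
  rw [this]
  exact Nat.cast_ne_zero.2 Fintype.card_ne_zero

/-! ### The stochastic operator and its ground state -/

/-- The `ℓ¹` norm. -/
noncomputable def l1Norm {n : ℕ} (v : LinkPattern n →₀ ℂ) : ℝ := ∑ π, ‖v π‖

theorem l1Norm_nonneg {n : ℕ} (v : LinkPattern n →₀ ℂ) : 0 ≤ l1Norm v :=
  Finset.sum_nonneg fun _ _ => norm_nonneg _

theorem eq_zero_of_l1Norm_le {n : ℕ} {v : LinkPattern n →₀ ℂ} (h : l1Norm v ≤ 0) : v = 0 := by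
  have h0 := le_antisymm h (l1Norm_nonneg v)
  rw [l1Norm, Finset.sum_eq_zero_iff_of_nonneg fun _ _ => norm_nonneg _] at h0
  exact Finsupp.ext fun π => norm_eq_zero.1 (h0 π (Finset.mem_univ _))

theorem l1Norm_smul {n : ℕ} (c : ℂ) (v : LinkPattern n →₀ ℂ) :
    l1Norm (c • v) = ‖c‖ * l1Norm v := by
  simp only [l1Norm, Finsupp.smul_apply, smul_eq_mul, norm_mul, Finset.mul_sum]

theorem l1Norm_add_le {n : ℕ} (v w : LinkPattern n →₀ ℂ) :
    l1Norm (v + w) ≤ l1Norm v + l1Norm w := by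
  rw [l1Norm, l1Norm, l1Norm, ← Finset.sum_add_distrib]
  exact Finset.sum_le_sum fun π _ => norm_add_le _ _

theorem l1Norm_sum_le {n : ℕ} {ι : Type*} (s : Finset ι) (v : ι → LinkPattern n →₀ ℂ) :
    l1Norm (∑ i ∈ s, v i) ≤ ∑ i ∈ s, l1Norm (v i) := by
  simp only [l1Norm]
  rw [Finset.sum_comm]
  refine Finset.sum_le_sum fun π _ => ?_
  rw [Finsupp.finsetSum_apply]
  exact norm_sum_le _ _

theorem l1Norm_single {n : ℕ} (π : LinkPattern n) (c : ℂ) :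
    l1Norm (Finsupp.single π c) = ‖c‖ := by
  classical
  rw [l1Norm, Finset.sum_eq_single π] <;> simp +contextual [eq_comm]

theorem mapDomain_eq_sum {n : ℕ} (f : LinkPattern n → LinkPattern n) (v : LinkPattern n →₀ ℂ) :
    Finsupp.mapDomain f v = ∑ π, Finsupp.single (f π) (v π) := by
  conv_lhs => rw [← Finsupp.univ_sum_single v]
  simp only [Finsupp.mapDomain_finsetSum, Finsupp.mapDomain_single]

theorem l1Norm_mapDomain_le {n : ℕ} (f : LinkPattern n → LinkPattern n) (v : LinkPattern n →₀ ℂ) :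
    l1Norm (Finsupp.mapDomain f v) ≤ l1Norm v := by
  rw [mapDomain_eq_sum]
  refine (l1Norm_sum_le _ _).trans_eq ?_
  simp only [l1Norm_single]
  rfl

theorem l1Norm_hamiltonian_le {n : ℕ} (v : LinkPattern n →₀ ℂ) :
    l1Norm (hamiltonian n v) ≤ 2 * n * l1Norm v := by
  rw [hamiltonian_apply]
  refine (l1Norm_sum_le _ _).trans
    ((Finset.sum_le_sum fun k _ => l1Norm_mapDomain_le (tlMap k) v).trans_eq ?_)
  simp

/-- The operators `e_0, e_2, …, e_{2 m - 2}` applied in this order. -/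
def pairUp {n : ℕ} (hn : 0 < n) : ℕ → LinkPattern n → LinkPattern n
  | 0, π => π
  | m + 1, π => tlMap ⟨2 * m % (2 * n), Nat.mod_lt _ (by omega)⟩ (pairUp hn m π)

theorem pairUp_apply {n : ℕ} (hn : 0 < n) {m : ℕ} (hm : m ≤ n) (π : LinkPattern n) {i : ℕ}
    (hi : i < m) : (pairUp hn m π).1 ⟨2 * i, by omega⟩ = ⟨2 * i + 1, by omega⟩ := by
  induction m with
  | zero => omega
  | succ m ih =>
    have hj : (⟨2 * m % (2 * n), Nat.mod_lt _ (by omega)⟩ : Fin (2 * n)) =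
        ⟨2 * m, by omega⟩ := Fin.ext (Nat.mod_eq_of_lt (by omega))
    have hs : cyclicSucc (⟨2 * m, by omega⟩ : Fin (2 * n)) = ⟨2 * m + 1, by omega⟩ := by
      have := cyclicSucc_val (⟨2 * m, by omega⟩ : Fin (2 * n))
      simp only at this
      exact Fin.ext (by simp only; omega)
    rw [pairUp, hj, tlMap]
    by_cases him : i = m
    · subst him
      split_ifs with h
      · rw [h, hs]
      · simp only [reconnect, if_true, hs]
    · have ih' := ih (by omega) (by omega)
      split_ifs with h
      · exact ih'
      · have hinv := (pairUp hn m π).2.1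
        have e1 : (⟨2 * i, by omega⟩ : Fin (2 * n)) ≠ ⟨2 * m, by omega⟩ := by
          simp only [ne_eq, Fin.mk.injEq]; omega
        have e2 : (⟨2 * i, by omega⟩ : Fin (2 * n)) ≠ ⟨2 * m + 1, by omega⟩ := by
          simp only [ne_eq, Fin.mk.injEq]; omega
        have e3 : (⟨2 * i, by omega⟩ : Fin (2 * n)) ≠ (pairUp hn m π).1 ⟨2 * m, by omega⟩ := by
          intro hc
          have := hinv ⟨2 * m, by omega⟩
          rw [← hc, ih', Fin.mk.injEq] at this
          omega
        have e4 : (⟨2 * i, by omega⟩ : Fin (2 * n)) ≠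
            (pairUp hn m π).1 ⟨2 * m + 1, by omega⟩ := by
          intro hc
          have := hinv ⟨2 * m + 1, by omega⟩
          rw [← hc, ih', Fin.mk.injEq] at this
          omega
        simp only [reconnect, hs]
        rw [if_neg e1, if_neg e2, if_neg e3, if_neg e4, ih']

/-- All link patterns are sent to the one that pairs `2 i` with `2 i + 1`. -/
theorem pairUp_eq {n : ℕ} (hn : 0 < n) (π ρ : LinkPattern n) : pairUp hn n π = pairUp hn n ρ := by
  refine Subtype.ext (funext fun j => ?_)
  have hj := j.isLt
  have h1 := pairUp_apply hn le_rfl π (i := j.val / 2) (by omega)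
  have h2 := pairUp_apply hn le_rfl ρ (i := j.val / 2) (by omega)
  by_cases he : j.val % 2 = 0
  · have : j = ⟨2 * (j.val / 2), by omega⟩ := Fin.ext (by simp only; omega)
    rw [this, h1, h2]
  · have : j = ⟨2 * (j.val / 2) + 1, by omega⟩ := Fin.ext (by simp only; omega)
    rw [this, ← h1, (pairUp hn n π).2.1, h1, ← h2, (pairUp hn n ρ).2.1]

/-- In `H ^ m`, a sum of `(2 n) ^ m` contractions, a single word is left out. -/
theorem l1Norm_pow_sub_le {n : ℕ} (hn : 0 < n) (m : ℕ) (w : LinkPattern n →₀ ℂ) :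
    l1Norm ((hamiltonian n ^ m) w - Finsupp.mapDomain (pairUp hn m) w) ≤
      ((2 * n : ℝ) ^ m - 1) * l1Norm w := by
  induction m with
  | zero =>
    have : pairUp hn 0 = id := rfl
    simp [this, l1Norm]
  | succ m ih =>
    set k : Fin (2 * n) := ⟨2 * m % (2 * n), Nat.mod_lt _ (by omega)⟩ with hk
    set u := Finsupp.mapDomain (pairUp hn m) w with hu
    have hcomp : Finsupp.mapDomain (pairUp hn (m + 1)) w = Finsupp.mapDomain (tlMap k) u := by
      rw [hu, ← Finsupp.mapDomain_comp]
      rfl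
    have hH : hamiltonian n u = Finsupp.mapDomain (tlMap k) u +
        ∑ j ∈ Finset.univ.erase k, Finsupp.mapDomain (tlMap j) u := by
      rw [hamiltonian_apply]
      exact (Finset.add_sum_erase _ (fun j => Finsupp.mapDomain (tlMap j) u)
        (Finset.mem_univ k)).symm
    have hsplit : (hamiltonian n ^ (m + 1)) w - Finsupp.mapDomain (pairUp hn (m + 1)) w =
        hamiltonian n ((hamiltonian n ^ m) w - u) +
          ∑ j ∈ Finset.univ.erase k, Finsupp.mapDomain (tlMap j) u := by
      rw [hcomp, pow_succ', Module.End.mul_apply, map_sub, hH]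
      abel
    rw [hsplit]
    have h1 := l1Norm_hamiltonian_le ((hamiltonian n ^ m) w - u)
    have h2 : l1Norm (∑ j ∈ Finset.univ.erase k, Finsupp.mapDomain (tlMap j) u) ≤
        (2 * n - 1) * l1Norm w := by
      refine (l1Norm_sum_le _ _).trans ((Finset.sum_le_sum fun j _ =>
        (l1Norm_mapDomain_le (tlMap j) u).trans (l1Norm_mapDomain_le _ w)).trans_eq ?_)
      rw [Finset.sum_const, Finset.card_erase_of_mem (Finset.mem_univ _), Finset.card_univ,
        Fintype.card_fin, nsmul_eq_mul, Nat.cast_sub (by omega)]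
      push_cast
      ring
    refine (l1Norm_add_le _ _).trans ((add_le_add (h1.trans
      (mul_le_mul_of_nonneg_left ih (by positivity))) h2).trans_eq ?_)
    ring

theorem coeffSum_sub_smul {n : ℕ} (v w : LinkPattern n →₀ ℂ) (c : ℂ) :
    coeffSum (v - c • w) = coeffSum v - c * coeffSum w := by
  simp [coeffSum, Finset.mul_sum]

/-- A vector of the eigenspace with vanishing sum of coefficients is zero: one word of `H ^ n` kills
it, and the other words are contractions. -/
theorem eq_zero_of_hamiltonian_eq {n : ℕ} (hn : 0 < n) {w : LinkPattern n →₀ ℂ}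
    (hw : hamiltonian n w = (2 * n : ℂ) • w) (h0 : coeffSum w = 0) : w = 0 := by
  have hpow : ∀ m, (hamiltonian n ^ m) w = ((2 * n : ℂ) ^ m) • w := by
    intro m
    induction m with
    | zero => simp
    | succ m ih => rw [pow_succ', Module.End.mul_apply, ih, map_smul, hw, smul_smul, pow_succ]
  have hkill : Finsupp.mapDomain (pairUp hn n) w = 0 := by
    obtain hemp | ⟨⟨π₀⟩⟩ := isEmpty_or_nonempty (LinkPattern n)
    · exact Subsingleton.elim _ _
    · rw [mapDomain_eq_sum, Finset.sum_congr rfl fun π _ => by rw [pairUp_eq hn π π₀],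
        ← Finsupp.single_finsetSum]
      have : ∑ π, w π = 0 := h0
      rw [this, Finsupp.single_zero]
  have h := l1Norm_pow_sub_le hn n w
  rw [hkill, sub_zero, hpow, l1Norm_smul] at h
  have hnorm : ‖(2 * n : ℂ) ^ n‖ = (2 * n : ℝ) ^ n := by simp
  rw [hnorm] at h
  exact eq_zero_of_l1Norm_le (by linarith)

theorem exists_smul_fplState {n : ℕ} (hn : 0 < n) {v : LinkPattern n →₀ ℂ}
    (hv : hamiltonian n v = (2 * n : ℂ) • v) : ∃ c : ℂ, v = c • fplState n := by
  have hs := coeffSum_fplState_ne_zero n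
  refine ⟨coeffSum v / coeffSum (fplState n), ?_⟩
  rw [← sub_eq_zero]
  refine eq_zero_of_hamiltonian_eq hn ?_ ?_
  · rw [map_sub, map_smul, hv, hamiltonian_fplState hn, smul_sub, smul_comm]
  · rw [coeffSum_sub_smul, div_mul_cancel₀ _ hs, sub_self]

theorem norm_eigenvalue_le {n : ℕ} {μ : ℂ} (h : (hamiltonian n).HasEigenvalue μ) :
    ‖μ‖ ≤ 2 * n := by
  obtain ⟨v, hv⟩ := h.exists_hasEigenvector
  have h1 := l1Norm_hamiltonian_le v
  rw [hv.apply_eq_smul, l1Norm_smul] at h1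
  have hpos : 0 < l1Norm v := by
    by_contra! hc
    exact hv.2 (eq_zero_of_l1Norm_le hc)
  exact le_of_mul_le_mul_right h1 hpos

theorem existsUnique_hasLinkPattern {n : ℕ} (φ : FPL n) :
    ∃! π : LinkPattern n, HasLinkPattern φ π :=
  ⟨linkPattern (fplEquiv n φ), hasLinkPattern_iff_eq.2 rfl,
    fun _ h => (hasLinkPattern_iff_eq.1 h).symm⟩

theorem mainTheorem1 (n : ℕ) (hn : 1 ≤ n) :
    (∀ φ : FPL n, ∃! π : LinkPattern n, HasLinkPattern φ π) ∧
    hamiltonian n (fplState n) = (2 * n : ℂ) • fplState n ∧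
    fplState n ≠ 0 ∧
    (∀ v : LinkPattern n →₀ ℂ, hamiltonian n v = (2 * n : ℂ) • v →
      ∃ c : ℂ, v = c • fplState n) ∧
    (∀ μ : ℂ, (hamiltonian n).HasEigenvalue μ → ‖μ‖ ≤ 2 * n) := by
  refine ⟨existsUnique_hasLinkPattern, hamiltonian_fplState hn, fun h => ?_,
    fun v hv => exists_smul_fplState hn hv, fun μ hμ => norm_eigenvalue_le hμ⟩
  apply coeffSum_fplState_ne_zero n
  rw [h]
  simp [coeffSum]
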